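/- Let $p$ be a prime and write $\mathbb{Z}/p^\infty=\mathbb{Z}[1/p]/\mathbb{Z}$. A group $G$ is discrete $p$-toral if it has a normal subgroup $G_0\cong(\mathbb{Z}/p^\infty)^k$ for some $k\ge 0$ such that $G/G_0$ is a finite $p$-group; its order is $|G|=(k,|G/G_0|)\in\mathbb{N}^2$, and orders are compared lexicographically. A fusion system $\mathcal{F}$ over a discrete $p$-toral group $S$ is a category whose objects are the subgroups of $S$ and whose morphisms $P\to Q$ are injective group homomorphisms, including all those induced by conjugation by elements of $S$, such that every morphism is an isomorphism of $\mathcal{F}$ followed by an inclusion. Write $\mathrm{Aut}_{\mathcal{F}}(P)$ for the group of $\mathcal{F}$-automorphisms of $P$, $\mathrm{Out}_{\mathcal{F}}(P)=\mathrm{Aut}_{\mathcal{F}}(P)/\mathrm{Inn}(P)$, $\mathrm{Aut}_S(P)$ for the group of automorphisms of $P$ induced by conjugation in $S$, $\mathrm{Out}_S(P)=\mathrm{Aut}_S(P)/\mathrm{Inn}(P)$, and $c_g(x)=gxg^{-1}$. A subgroup $P\le S$ is fully centralized (resp. fully normalized) if $|C_S(P)|\ge|C_S(P')|$ (resp. $|N_S(P)|\ge|N_S(P')|$)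 for every $P'\le S$ that is isomorphic to $P$ in $\mathcal{F}$. The fusion system $\mathcal{F}$ is saturated if: (I) for every fully normalized $P\le S$, $P$ is fully centralized, $\mathrm{Out}_{\mathcal{F}}(P)$ is finite, and $\mathrm{Out}_S(P)$ is a Sylow $p$-subgroup of $\mathrm{Out}_{\mathcal{F}}(P)$; (II) for all $P\le S$ and $\varphi\in\mathrm{Hom}_{\mathcal{F}}(P,S)$ with $\varphi(P)$ fully centralized, $\varphi$ extends to some $\bar\varphi\in\mathrm{Hom}_{\mathcal{F}}(N_\varphi,S)$, where $N_\varphi=\{g\in N_S(P)\mid \varphi c_g\varphi^{-1}\in\mathrm{Aut}_S(\varphi(P))\}$; (III) if $P_1\le P_2\le\cdots$ are subgroups of $S$ with union $P_\infty$ and $\varphi\colon P_\infty\to S$ is a homomorphism with $\varphi|_{P_n}\in\mathrm{Hom}_{\mathcal{F}}(P_n,S)$ for all $n$, then $\varphi\in\mathrm{Hom}_{\mathcal{F}}(P_\infty,S)$. **Theorem.** Let $\mathcal{F}$ be a saturated fusion system over a discrete $p$-toral group $S$. Then there exists a faithful finite-dimensional complex unitary representation $\rho\colon S\to U(n)$,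 for some $n$, which is fusion-preserving ($\mathcal{F}$-invariant): for every $P\le S$ and every $f\in\mathrm{Hom}_{\mathcal{F}}(P,S)$, the representations $\rho|_P$ and $\rho|_{f(P)}\circ f$ of $P$ are isomorphic. -/

import Mathlib

/-! ### Discrete `p`-toral groups -/

/-- The group `ℤ/p^∞ ≅ ℤ[1/p]/ℤ`, realized as the union of the cyclic subgroups of order `p ^ n`
in `ℝ/ℤ`, that is, the classes of the rationals `a / p ^ n`. -/
def PruferGroup (p : ℕ) : AddSubgroup UnitAddCircle where
  carrier := {x | ∃ n : ℕ, p ^ n • x = 0}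
  zero_mem' := ⟨0, smul_zero _⟩
  add_mem' := by
    rintro x y ⟨m, hm⟩ ⟨n, hn⟩
    refine ⟨m + n, ?_⟩
    rw [smul_add, pow_add, mul_smul, mul_smul, hn, smul_zero, add_zero, ← mul_smul, mul_comm,
      mul_smul, hm, smul_zero]
  neg_mem' := by
    rintro x ⟨n, hn⟩
    exact ⟨n, by rw [smul_neg, hn, neg_zero]⟩

/-- `G` is a discrete `p`-toral group of order `(k, m)`: there is a normal subgroup `G₀` (the
identity component) isomorphic to `(ℤ/p^∞)^k` such that `G / G₀` is a finite `p`-group with `m`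
elements. -/
def HasPToralOrder (p : ℕ) (G : Type*) [Group G] (k m : ℕ) : Prop :=
  ∃ G₀ : Subgroup G, ∃ _ : G₀.Normal,
    Nonempty (G₀ ≃* Multiplicative (Fin k → PruferGroup p)) ∧
      Finite (G ⧸ G₀) ∧ IsPGroup p (G ⧸ G₀) ∧ Nat.card (G ⧸ G₀) = m

/-- `G` is a discrete `p`-toral group. -/
def IsDiscretePToral (p : ℕ) (G : Type*) [Group G] : Prop :=
  ∃ k m : ℕ, HasPToralOrder p G k m

/-- The comparison `|G| ≤ |H|` of the orders of discrete `p`-toral groups, in the lexicographic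
ordering of `ℕ × ℕ`. (The order of a discrete `p`-toral group is unique.) -/
def PToralOrderLE (p : ℕ) (G H : Type*) [Group G] [Group H] : Prop :=
  ∃ k m k' m' : ℕ, HasPToralOrder p G k m ∧ HasPToralOrder p H k' m' ∧
    (k < k' ∨ k = k' ∧ m ≤ m')

/-! ### Fusion systems -/

/-- A fusion system over a group `S`: a category whose objects are the subgroups of `S` and whose
morphisms `P → Q` are injective homomorphisms, among them all those induced by conjugation by an
element of `S` (so the identities and the inclusions, given by conjugation by `1`), such that every
morphism is an isomorphism of the category followed by an inclusion. -/
structure FusionSystem (S : Type*) [Group S] where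
  /-- The set of morphisms from `P` to `Q`. -/
  Hom (P Q : Subgroup S) : Set (P →* Q)
  comp_mem : ∀ {P Q R : Subgroup S} {φ : P →* Q} {ψ : Q →* R},
    φ ∈ Hom P Q → ψ ∈ Hom Q R → ψ.comp φ ∈ Hom P R
  conj_mem : ∀ {P Q : Subgroup S} (φ : P →* Q),
    (∃ g : S, ∀ x : P, (φ x : S) = g * x * g⁻¹) → φ ∈ Hom P Q
  injective : ∀ {P Q : Subgroup S} {φ : P →* Q}, φ ∈ Hom P Q → Function.Injective φ
  factor : ∀ {P Q : Subgroup S} {φ : P →* Q}, φ ∈ Hom P Q →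
    ∃ (R : Subgroup S) (hR : R ≤ Q) (e : P ≃* R),
      e.toMonoidHom ∈ Hom P R ∧ e.symm.toMonoidHom ∈ Hom R P ∧
        φ = (Subgroup.inclusion hR).comp e.toMonoidHom

/-- The subgroup `Aut_S(P)` of the automorphisms of `P` induced by conjugation in `S`. -/
def conjAut {S : Type*} [Group S] (P : Subgroup S) : Subgroup (MulAut P) where
  carrier := {e | ∃ g : S, ∀ x : P, (e x : S) = g * x * g⁻¹}
  one_mem' := ⟨1, fun x => by simp⟩
  mul_mem' := by
    rintro a b ⟨g, hg⟩ ⟨h, hh⟩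
    refine ⟨g * h, fun x => ?_⟩
    rw [MulAut.mul_apply, hg, hh]
    group
  inv_mem' := by
    rintro a ⟨g, hg⟩
    refine ⟨g⁻¹, fun x => ?_⟩
    have h := hg (a⁻¹ x)
    rw [MulAut.apply_inv_self] at h
    rw [h]
    group

/-- The inner automorphisms of a group form a normal subgroup of any group of automorphisms. -/
instance innSubgroupOfNormal {G : Type*} [Group G] (A : Subgroup (MulAut G)) :
    ((MulAut.conj : G →* MulAut G).range.subgroupOf A).Normal where
  conj_mem := by
    rintro ⟨n, hn⟩ h ⟨a, ha⟩
    rw [Subgroup.mem_subgroupOf] at h ⊢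
    obtain ⟨g, hg⟩ := h
    refine ⟨a g, ?_⟩
    change MulAut.conj g = n at hg
    change MulAut.conj (a g) = a * n * a⁻¹
    rw [← hg]
    ext x
    simp [MulAut.mul_apply]

namespace FusionSystem

variable {S : Type*} [Group S] (F : FusionSystem S)

/-- `Hom_F(P, S)`, as a set of homomorphisms `P → S`. -/
def HomS (P : Subgroup S) : Set (P →* S) :=
  {φ | (Subgroup.topEquiv.symm.toMonoidHom : S →* (⊤ : Subgroup S)).comp φ ∈ F.Hom P ⊤}

/-- `Iso_F(P, Q)`: the isomorphisms of the category `F`. -/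
def Iso (P Q : Subgroup S) : Set (P ≃* Q) :=
  {e | e.toMonoidHom ∈ F.Hom P Q ∧ e.symm.toMonoidHom ∈ F.Hom Q P}

/-- Two subgroups are `F`-conjugate if they are isomorphic in `F`. -/
def IsConjugate (P Q : Subgroup S) : Prop := (F.Iso P Q).Nonempty

/-- `Aut_F(P) = Iso_F(P, P)`, as a group under composition. -/
def aut (P : Subgroup S) : Subgroup (MulAut P) where
  carrier := F.Iso P P
  one_mem' := ⟨F.conj_mem _ ⟨1, fun x => by simp⟩, F.conj_mem _ ⟨1, fun x => by simp [MulAut.one_def]⟩⟩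
  mul_mem' := fun ha hb => ⟨F.comp_mem hb.1 ha.1, F.comp_mem ha.2 hb.2⟩
  inv_mem' := fun ha => ⟨ha.2, ha.1⟩

/-- `Out_F(P) = Aut_F(P) / Inn(P)`. -/
abbrev Out (P : Subgroup S) : Type _ :=
  F.aut P ⧸ (MulAut.conj : P →* MulAut P).range.subgroupOf (F.aut P)

/-- `Out_S(P) = Aut_S(P) / Inn(P)`, as a subgroup of `Out_F(P)`: the image of `Aut_S(P)`, which is
contained in `Aut_F(P)`. -/
def outS (P : Subgroup S) : Subgroup (F.Out P) :=
  ((conjAut P).subgroupOf (F.aut P)).map (QuotientGroup.mk' _)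

/-- `P` is fully centralized in `F`. -/
def FullyCentralized (p : ℕ) (P : Subgroup S) : Prop :=
  ∀ P' : Subgroup S, F.IsConjugate P P' →
    PToralOrderLE p (Subgroup.centralizer (P' : Set S)) (Subgroup.centralizer (P : Set S))

/-- `P` is fully normalized in `F`. -/
def FullyNormalized (p : ℕ) (P : Subgroup S) : Prop :=
  ∀ P' : Subgroup S, F.IsConjugate P P' →
    PToralOrderLE p (Subgroup.normalizer (P' : Set S)) (Subgroup.normalizer (P : Set S))

/-- The subgroup `N_φ` of the `g ∈ N_S(P)` such that `φ ∘ c_g ∘ φ⁻¹` is an automorphism of `φ(P)`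
induced by conjugation by an element `h` of `S`, that is, `φ (g x g⁻¹) = h φ(x) h⁻¹` for all
`x ∈ P`. -/
def extender {P : Subgroup S} (φ : P →* S) : Subgroup S where
  carrier := {g | g ∈ Subgroup.normalizer (P : Set S) ∧
    ∃ h : S, ∀ x y : P, (y : S) = g * x * g⁻¹ → φ y = h * φ x * h⁻¹}
  one_mem' := ⟨one_mem _, 1, fun x y hxy => by
    have : y = x := Subtype.ext (by simpa using hxy)
    simp [this]⟩
  mul_mem' := by
    rintro a b ⟨ha, h, hh⟩ ⟨hb, k, hk⟩
    refine ⟨mul_mem ha hb, h * k, fun x y hxy => ?_⟩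
    have hz : b * (x : S) * b⁻¹ ∈ P := (Subgroup.mem_normalizer_iff.mp hb x).mp x.2
    rw [hh ⟨_, hz⟩ y (by rw [hxy]; group), hk x ⟨_, hz⟩ rfl]
    group
  inv_mem' := by
    rintro a ⟨ha, h, hh⟩
    refine ⟨inv_mem ha, h⁻¹, fun x y hxy => ?_⟩
    rw [hh y x (by rw [hxy]; group)]
    group

theorem le_extender {P : Subgroup S} (φ : P →* S) : P ≤ extender φ := by
  intro g hg
  refine ⟨Subgroup.le_normalizer hg, φ ⟨g, hg⟩, fun x y hxy => ?_⟩
  have : y = ⟨g, hg⟩ * x * ⟨g, hg⟩⁻¹ := Subtype.ext hxy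
  rw [this, map_mul, map_mul, map_inv]

/-- The saturation axioms, for a fusion system over a discrete `p`-toral group. -/
structure IsSaturated (p : ℕ) : Prop where
  sylow : ∀ P : Subgroup S, F.FullyNormalized p P →
    F.FullyCentralized p P ∧ Finite (F.Out P) ∧
      ∃ Q : Sylow p (F.Out P), (Q : Subgroup (F.Out P)) = F.outS P
  extension : ∀ (P : Subgroup S) (φ : P →* S), φ ∈ F.HomS P → F.FullyCentralized p φ.range →
    ∃ ψ ∈ F.HomS (extender φ), ψ.comp (Subgroup.inclusion (le_extender φ)) = φ
  continuity : ∀ (P : ℕ → Subgroup S), Monotone P → ∀ φ : (⨆ n, P n : Subgroup S) →* S,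
    (∀ n, φ.comp (Subgroup.inclusion (le_iSup P n)) ∈ F.HomS (P n)) → φ ∈ F.HomS (⨆ n, P n)

/-- A complex representation `ρ` of `S` is `F`-invariant (fusion-preserving) if for every
`P ≤ S` and every `f ∈ Hom_F(P, S)` the representations `ρ|_P` and `ρ|_{f(P)} ∘ f` of `P` are
isomorphic. -/
def IsInvariant {V : Type*} [AddCommGroup V] [Module ℂ V] (ρ : Representation ℂ S V) : Prop :=
  ∀ (P : Subgroup S) (f : P →* S), f ∈ F.HomS P →
    Nonempty (Representation.Equiv (ρ.comp P.subtype : Representation ℂ P V)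
      (ρ.comp f : Representation ℂ P V))

end FusionSystem

/-!
Let `T` be the identity component of `S`. A morphism of `F` between subgroups of `T` extends to an
element of the finite group `Aut_F(T)`, because its composite with an isomorphism onto a fully
centralized target extends over centralizers, which contain `T`. It therefore suffices to find an
`Aut_F(T)`-invariant sum `θ` of characters of `T`, with trivial common kernel, that vanishes at
each `z ∈ T` which is `F`-conjugate to some `x ∉ T`: the representation of `S` induced by `θ` has
character `|S/T| θ` on `T` and `0` off `T`, which is constant on `F`-conjugacy classes, and over
the locally finite group `S` representations with equal characters are isomorphic.

If `z` is `F`-conjugate to `x ∉ T`, then up to `Aut_F(T)` some power of `z`, but not `z` itself, is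
in the image of the norm `t ↦ t · α(t) ⋯ αⁿ⁻¹(t)` of an `α ∈ Aut_F(T)` of order dividing
`n = |S/T|`, namely of conjugation by `x`. These images are divisible and finite in number, so for
some `m` a finite, jointly injective set of characters contains, for every such `z` up to
`Aut_F(T)`, some `χ` with `χ(z) ≠ 1 = χ(z)ᵐ`. As `1 + χ + ⋯ + χᵐ⁻¹` vanishes at `z`, the product of these sums over all
`Aut_F(T)`-translates of the `χ` is the required `θ`.
-/

open scoped IsMulCommutative

section RepresentationsAndCharacters

open Module

variable {k G V W V' W' : Type*} [Field k] [Group G]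
  [AddCommGroup V] [Module k V] [AddCommGroup W] [Module k W]
  [AddCommGroup V'] [Module k V'] [AddCommGroup W'] [Module k W']
  {ρ : Representation k G V} {σ : Representation k G W}
  {ρ' : Representation k G V'} {σ' : Representation k G W'}

theorem character_prod [FiniteDimensional k V] [FiniteDimensional k W] (g : G) :
    (ρ.prod σ).character g = ρ.character g + σ.character g :=
  LinearMap.trace_prodMap' (ρ g) (σ g)

theorem nonempty_equiv_prod_congr (e : ρ.Equiv ρ') (f : σ.Equiv σ') :
    Nonempty ((ρ.prod σ).Equiv (ρ'.prod σ')) :=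
  ⟨.mk (e.toLinearEquiv.prodCongr f.toLinearEquiv) fun g => LinearMap.ext fun v =>
    Prod.ext (e.isIntertwining _ _ g v.1) (f.isIntertwining _ _ g v.2)⟩

theorem isCompl_toSubmodule {p q : Subrepresentation ρ} (h : IsCompl p q) :
    IsCompl p.toSubmodule q.toSubmodule :=
  ⟨disjoint_iff.mpr (congrArg Subrepresentation.toSubmodule h.inf_eq_bot),
    codisjoint_iff.mpr (congrArg Subrepresentation.toSubmodule h.sup_eq_top)⟩

theorem nonempty_equiv_prod_of_isCompl {p q : Subrepresentation ρ} (h : IsCompl p q) :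
    Nonempty (ρ.Equiv (p.toRepresentation.prod q.toRepresentation)) :=
  ⟨.symm <| .mk (Submodule.prodEquivOfIsCompl _ _ (isCompl_toSubmodule h)) fun g =>
    LinearMap.ext fun v => ((ρ g).map_add v.1 v.2).symm⟩

theorem nonempty_equiv_range_of_isCompl_ker (f : ρ.IntertwiningMap σ) {q : Subrepresentation ρ}
    (h : IsCompl f.ker q) : Nonempty (q.toRepresentation.Equiv f.range.toRepresentation) :=
  ⟨.mk (f.toLinearMap.kerComplementEquivRange (isCompl_toSubmodule h).symm) fun g =>
    LinearMap.ext fun v => Subtype.ext (f.isIntertwining _ _ g v)⟩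

section Finite

variable [Finite G] [CharZero k]

theorem nonempty_equiv_ker_prod_range (f : ρ.IntertwiningMap σ) :
    Nonempty (ρ.Equiv (f.ker.toRepresentation.prod f.range.toRepresentation)) := by
  obtain ⟨q, hq⟩ := exists_isCompl f.ker
  obtain ⟨e⟩ := nonempty_equiv_prod_of_isCompl hq
  obtain ⟨e'⟩ := nonempty_equiv_range_of_isCompl_ker f hq
  obtain ⟨e''⟩ := nonempty_equiv_prod_congr (.refl f.ker.toRepresentation) e'
  exact ⟨e.trans e''⟩

theorem exists_intertwiningMap_ne_zero_of_character_eq [FiniteDimensional k V]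
    [FiniteDimensional k W] [Nontrivial V] (h : ρ.character = σ.character) :
    ∃ f : ρ.IntertwiningMap σ, f ≠ 0 := by
  cases nonempty_fintype G
  have : Invertible (Nat.card G : k) := invertibleOfNonzero (by simp)
  have hfinrank : finrank k (ρ.IntertwiningMap σ) = finrank k (ρ.IntertwiningMap ρ) := by
    rw [← Nat.cast_inj (R := k), ← Representation.card_inv_mul_sum_char_mul_char_eq_finrank,
      ← Representation.card_inv_mul_sum_char_mul_char_eq_finrank, h]
  have : Nontrivial (ρ.IntertwiningMap ρ) := by
    obtain ⟨v, hv⟩ := exists_ne (0 : V)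
    exact ⟨.id ρ, 0, fun h => hv (congrArg (fun f : ρ.IntertwiningMap ρ => f v) h)⟩
  have : Nontrivial (ρ.IntertwiningMap σ) :=
    nontrivial_of_finrank_pos (R := k) (hfinrank ▸ finrank_pos)
  exact exists_ne 0

theorem nonempty_equiv_of_character_eq [FiniteDimensional k V] [FiniteDimensional k W]
    (h : ρ.character = σ.character) : Nonempty (ρ.Equiv σ) := by
  induction hn : finrank k V using Nat.strong_induction_on generalizing V W with
  | _ n ih =>
  have hdim : finrank k V = finrank k W := by
    rw [← Nat.cast_inj (R := k), ← ρ.char_one, ← σ.char_one, h]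
  rcases subsingleton_or_nontrivial V with hV | hV
  · have : Subsingleton W := by
      rw [← finrank_zero_iff (R := k), ← hdim, finrank_zero_of_subsingleton]
    exact ⟨.mk (LinearEquiv.ofSubsingleton V W) fun g => Subsingleton.elim _ _⟩
  obtain ⟨f, hf⟩ := exists_intertwiningMap_ne_zero_of_character_eq h
  obtain ⟨e⟩ := nonempty_equiv_ker_prod_range f
  obtain ⟨q, hq⟩ := exists_isCompl f.range
  obtain ⟨e'⟩ := nonempty_equiv_prod_of_isCompl hq.symm
  have hker : f.ker.toRepresentation.character = q.toRepresentation.character := by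
    ext g
    have hg := congrFun h g
    rw [Representation.char_iso e, Representation.char_iso e', character_prod,
      character_prod] at hg
    exact add_right_cancel hg
  have hlt : finrank k f.ker.toSubmodule < n := hn ▸ Submodule.finrank_lt fun htop =>
    hf (Representation.IntertwiningMap.ext (LinearMap.ker_eq_top.mp htop))
  obtain ⟨e₁⟩ := ih _ hlt hker rfl
  obtain ⟨e₂⟩ := nonempty_equiv_prod_congr e₁ (.refl f.range.toRepresentation)
  exact ⟨(e.trans e₂).trans e'.symm⟩

end Finite

variable (ρ σ) in
/-- The linear maps `V → W` that commute with the action of the subgroup `H`. -/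
def commutingMaps (H : Subgroup G) : Submodule k (V →ₗ[k] W) where
  carrier := {f | ∀ g ∈ H, f ∘ₗ ρ g = σ g ∘ₗ f}
  zero_mem' g _ := by rw [LinearMap.zero_comp, LinearMap.comp_zero]
  add_mem' ha hb g hg := by rw [LinearMap.add_comp, ha g hg, hb g hg, LinearMap.comp_add]
  smul_mem' c f hf g hg := by rw [LinearMap.smul_comp, hf g hg, LinearMap.comp_smul]

theorem commutingMaps_anti : Antitone (commutingMaps ρ σ) :=
  fun _ _ hHK _ hf g hg => hf g (hHK hg)

theorem exists_finset_commutingMaps_closure_le [FiniteDimensional k V] [FiniteDimensional k W] :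
    ∃ s : Finset G, commutingMaps ρ σ (.closure s) ≤ commutingMaps ρ σ ⊤ := by
  classical
  obtain ⟨s, -, hs⟩ := exists_minimalFor_of_wellFoundedLT (fun _ : Finset G => True)
    (fun s => finrank k (commutingMaps ρ σ (.closure s))) ⟨∅, trivial⟩
  refine ⟨s, fun f hf g _ => ?_⟩
  have hle : commutingMaps ρ σ (.closure (insert g s : Finset G)) ≤
      commutingMaps ρ σ (.closure s) :=
    commutingMaps_anti (Subgroup.closure_mono (Finset.coe_subset.mpr (Finset.subset_insert g s)))
  have heq := Submodule.eq_of_le_of_finrank_le hle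
    (hs trivial (Submodule.finrank_mono hle))
  exact (heq ▸ hf : f ∈ commutingMaps ρ σ (.closure (insert g s : Finset G))) g
    (Subgroup.subset_closure (Finset.mem_insert_self g s))

theorem nonempty_equiv_of_character_eq_of_locallyFinite [CharZero k] [FiniteDimensional k V]
    [FiniteDimensional k W] (hG : ∀ s : Finset G, Finite (Subgroup.closure (s : Set G)))
    (h : ρ.character = σ.character) : Nonempty (ρ.Equiv σ) := by
  obtain ⟨s, hs⟩ := exists_finset_commutingMaps_closure_le (ρ := ρ) (σ := σ)
  have := hG s
  obtain ⟨e⟩ := nonempty_equiv_of_character_eq (G := Subgroup.closure (s : Set G))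
    (ρ := ρ.comp (Subgroup.subtype _)) (σ := σ.comp (Subgroup.subtype _))
    (funext fun g => congrFun h g)
  have he : (e.toLinearEquiv : V →ₗ[k] W) ∈ commutingMaps ρ σ (.closure s) := fun x hx =>
    LinearMap.ext (e.isIntertwining _ _ ⟨x, hx⟩)
  exact ⟨.mk e.toLinearEquiv fun g => hs he g (Subgroup.mem_top g)⟩

end RepresentationsAndCharacters

section PTori

/-- A `p`-torus: an abelian `p`-group that is divisible by `p` and has finitely many elements of
order `p`. By `IsPTorus.exists_mulEquiv`, these are the groups isomorphic to `(ℤ/p^∞)^k`. -/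
structure IsPTorus (p : ℕ) (A : Type*) [CommGroup A] : Prop where
  isPGroup : IsPGroup p A
  exists_pow_eq : ∀ a : A, ∃ b : A, b ^ p = a
  finite_torsion : {a : A | a ^ p = 1}.Finite

variable {p : ℕ} {A B : Type*} [CommGroup A] [CommGroup B]

theorem finite_setOf_pow_eq_one_of_injective {G H : Type*} [Group G] [Group H] {f : G →* H}
    (hf : Function.Injective f) {n : ℕ} (hH : {y : H | y ^ n = 1}.Finite) :
    {x : G | x ^ n = 1}.Finite :=
  .of_finite_image (hH.subset (Set.image_subset_iff.mpr fun x (hx : x ^ n = 1) => by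
    rw [Set.mem_preimage, Set.mem_ofPred_eq, ← map_pow, hx, map_one])) hf.injOn

theorem finite_setOf_pow_mul_eq_one {m n : ℕ} (hm : {a : A | a ^ m = 1}.Finite)
    (hn : {a : A | a ^ n = 1}.Finite) : {a : A | a ^ (m * n) = 1}.Finite := by
  have hpre : {a : A | a ^ (m * n) = 1} = powMonoidHom m ⁻¹' {a | a ^ n = 1} :=
    Set.ext fun a => by simp only [Set.mem_ofPred_eq, Set.mem_preimage, powMonoidHom_apply, pow_mul]
  rw [hpre]
  refine hn.preimage' fun b _ => ?_
  rcases (powMonoidHom m ⁻¹' {b}).eq_empty_or_nonempty with hb | ⟨c, rfl⟩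
  · rw [hb]
    exact Set.finite_empty
  · refine (hm.image (c * ·)).subset fun a (ha : a ^ m = c ^ m) => ⟨c⁻¹ * a, ?_, by simp⟩
    rw [Set.mem_ofPred_eq, mul_pow, ha, inv_pow, inv_mul_cancel]

theorem finite_setOf_pow_pow_eq_one (h : {a : A | a ^ p = 1}.Finite) (n : ℕ) :
    {a : A | a ^ p ^ n = 1}.Finite := by
  induction n with
  | zero => simp
  | succ n ih => exact pow_succ p n ▸ finite_setOf_pow_mul_eq_one ih h

theorem injective_of_injOn_torsion {G H : Type*} [Group G] [Group H] (hG : IsPGroup p G)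
    (f : G →* H) (h : ∀ a, a ^ p = 1 → f a = 1 → a = 1) : Function.Injective f := by
  rw [injective_iff_map_eq_one]
  intro a ha
  obtain ⟨n, hn⟩ := hG a
  induction n with
  | zero => simpa using hn
  | succ n ih =>
    exact ih (h _ (by rw [← pow_mul, ← pow_succ, hn]) (by rw [map_pow, ha, one_pow]))

theorem surjective_of_torsion_le_range (hA : ∀ a : A, ∃ b, b ^ p = a) (hB : IsPGroup p B)
    (f : A →* B) (h : ∀ b, b ^ p = 1 → b ∈ f.range) : Function.Surjective f := by
  intro b
  obtain ⟨n, hn⟩ := hB b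
  induction n generalizing b with
  | zero => exact ⟨1, by simpa using hn.symm⟩
  | succ n ih =>
    obtain ⟨a, ha⟩ := ih (b ^ p) (by rw [← pow_mul, ← pow_succ', hn])
    obtain ⟨a', rfl⟩ := hA a
    obtain ⟨c, hc⟩ := h (b / f a') (by rw [div_pow, ← map_pow, ha, div_self'])
    exact ⟨c * a', by rw [map_mul, hc, div_mul_cancel]⟩

theorem exists_extension_of_exists_pow_eq {D : Type*} [CommGroup D]
    (hD : ∀ n : ℕ, n ≠ 0 → ∀ d : D, ∃ c, c ^ n = d) (H : Subgroup A) (g : H →* D) :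
    ∃ f : A →* D, ∀ x : H, f x = g x := by
  let : DivisibleBy (Additive D) ℕ :=
    divisibleByOfSMulRightSurj (Additive D) ℕ fun {n} hn => hD n hn
  let : DivisibleBy (Additive D) ℤ := AddGroup.divisibleByIntOfDivisibleByNat (Additive D)
  obtain ⟨f, hf⟩ := (Module.Baer.of_divisible (Additive D)).extension_property_addMonoidHom
    (MonoidHom.toAdditive H.subtype) H.subtype_injective (MonoidHom.toAdditive g)
  exact ⟨MonoidHom.toAdditive.symm f, DFunLike.congr_fun hf⟩

namespace IsPTorus

theorem of_mulEquiv (h : IsPTorus p A) (e : A ≃* B) : IsPTorus p B where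
  isPGroup := h.isPGroup.of_equiv e
  exists_pow_eq b := by
    obtain ⟨a, ha⟩ := h.exists_pow_eq (e.symm b)
    exact ⟨e a, by rw [← map_pow, ha, e.apply_symm_apply]⟩
  finite_torsion := finite_setOf_pow_eq_one_of_injective (f := e.symm.toMonoidHom)
    e.symm.injective h.finite_torsion

theorem pi {ι : Type*} [Finite ι] {A : ι → Type*} [∀ i, CommGroup (A i)]
    (h : ∀ i, IsPTorus p (A i)) : IsPTorus p (∀ i, A i) where
  isPGroup a := by
    cases nonempty_fintype ι
    choose n hn using fun i => (h i).isPGroup (a i)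
    refine ⟨∑ i, n i, funext fun i => ?_⟩
    have hdvd := pow_dvd_pow p
      (Finset.single_le_sum (fun j _ => Nat.zero_le (n j)) (Finset.mem_univ i))
    exact orderOf_dvd_iff_pow_eq_one.mp ((orderOf_dvd_iff_pow_eq_one.mpr (hn i)).trans hdvd)
  exists_pow_eq a := by
    choose b hb using fun i => (h i).exists_pow_eq (a i)
    exact ⟨b, funext hb⟩
  finite_torsion := (Set.Finite.pi' fun i => (h i).finite_torsion).subset
    fun _ ha i => congrFun ha i

theorem exists_pow_eq_of_ne_zero [Fact p.Prime] (h : IsPTorus p A) {n : ℕ} (hn : n ≠ 0) (a : A) :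
    ∃ b : A, b ^ n = a := by
  induction n using induction_on_primes generalizing a with
  | zero => exact absurd rfl hn
  | one => exact ⟨a, pow_one a⟩
  | prime_mul q n hq ih =>
    obtain ⟨b, rfl⟩ := ih (right_ne_zero_of_mul hn) a
    suffices ∃ c, c ^ q = b by
      obtain ⟨c, rfl⟩ := this
      exact ⟨c, pow_mul c q n⟩
    rcases eq_or_ne p q with rfl | hpq
    · exact h.exists_pow_eq b
    · exact (h.isPGroup.powEquiv'
        ((Nat.prime_dvd_prime_iff_eq Fact.out hq).not.mpr hpq)).surjective b

theorem finite_setOf_pow_eq_one [Fact p.Prime] (h : IsPTorus p A) {n : ℕ} (hn : n ≠ 0) :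
    {a : A | a ^ n = 1}.Finite := by
  induction n using induction_on_primes with
  | zero => exact absurd rfl hn
  | one => simp
  | prime_mul q n hq ih =>
    refine finite_setOf_pow_mul_eq_one ?_ (ih (right_ne_zero_of_mul hn))
    rcases eq_or_ne p q with rfl | hpq
    · exact h.finite_torsion
    · have hinj := (h.isPGroup.powEquiv'
        ((Nat.prime_dvd_prime_iff_eq Fact.out hq).not.mpr hpq)).injective
      exact (Set.finite_singleton 1).subset fun a ha => hinj (ha.trans (one_pow q).symm)

theorem surjective_of_injective (h : IsPTorus p A) (f : A →* A) (hf : Function.Injective f) :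
    Function.Surjective f := by
  have hmaps : Set.MapsTo f {a | a ^ p = 1} {a | a ^ p = 1} := fun a (ha : a ^ p = 1) => by
    rw [Set.mem_ofPred_eq, ← map_pow, ha, map_one]
  refine surjective_of_torsion_le_range h.exists_pow_eq h.isPGroup f fun b hb => ?_
  obtain ⟨a, -, ha⟩ := ((h.finite_torsion.injOn_iff_bijOn_of_mapsTo hmaps).mp hf.injOn).surjOn hb
  exact ⟨a, ha⟩

end IsPTorus

namespace PruferGroup

variable (p)

theorem isPTorus [Fact p.Prime] : IsPTorus p (Multiplicative (PruferGroup p)) where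
  isPGroup x := x.toAdd.2.imp fun _ hn => Subtype.ext hn
  exists_pow_eq x := by
    have hp : (p : ℤ) ≠ 0 := Nat.cast_ne_zero.mpr (Fact.out : p.Prime).ne_zero
    let y : UnitAddCircle := DivisibleBy.div x.toAdd.1 (p : ℤ)
    have hy : p • y = x.toAdd.1 := by
      rw [← natCast_zsmul, DivisibleBy.div_cancel _ hp]
    obtain ⟨n, hn⟩ := x.toAdd.2
    exact ⟨.ofAdd ⟨y, n + 1, by rw [pow_succ, mul_smul, hy, hn]⟩, Subtype.ext hy⟩
  finite_torsion := .of_finite_image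
    ((AddCircle.finite_torsion (1 : ℝ) (Fact.out : p.Prime).pos).subset
      (Set.image_subset_iff.mpr fun _ hx => congrArg Subtype.val hx))
    (f := fun x : Multiplicative (PruferGroup p) => x.toAdd.1) Subtype.val_injective.injOn

/-- The homomorphism `ℤ/p → ℤ/p^∞` that maps `1` to the class of `1/p`. -/
noncomputable def ofZMod [NeZero p] : ZMod p →+ PruferGroup p :=
  ZMod.toAddCircle.codRestrict (PruferGroup p) fun x => ⟨1, by
    rw [pow_one, ← map_nsmul, nsmul_eq_mul, CharP.cast_eq_zero, zero_mul, map_zero]⟩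

variable {p}

theorem ofZMod_injective [NeZero p] : Function.Injective (ofZMod p) :=
  fun _ _ h => ZMod.toAddCircle_injective p (congrArg Subtype.val h)

theorem exists_ofZMod_eq [NeZero p] {x : PruferGroup p} (hx : p • x = 0) :
    ∃ a, ofZMod p a = x := by
  obtain ⟨⟨r⟩, hr⟩ := x
  have hpr : ((p • r : ℝ) : UnitAddCircle) = 0 :=
    (AddCircle.coe_nsmul 1).trans (congrArg Subtype.val hx)
  obtain ⟨m, hm⟩ := (AddCircle.coe_eq_zero_iff (1 : ℝ)).mp hpr
  have hmr : (m / p : ℝ) = r := by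
    rw [zsmul_one, nsmul_eq_mul] at hm
    rw [hm, mul_div_cancel_left₀ _ (Nat.cast_ne_zero.mpr (NeZero.ne p))]
  exact ⟨m, Subtype.ext ((ZMod.toAddCircle_intCast m).trans (congrArg _ hmr))⟩

theorem isPTorus_pi [Fact p.Prime] (k : ℕ) : IsPTorus p (Multiplicative (Fin k → PruferGroup p)) :=
  (IsPTorus.pi fun _ => isPTorus p).of_mulEquiv (MulEquiv.funMultiplicative _ _).symm

end PruferGroup

variable [Fact p.Prime]

theorem exists_embedding_of_forall_pow_eq_one [Finite A] (hA : ∀ a : A, a ^ p = 1) :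
    ∃ (k : ℕ) (f : A →* Multiplicative (Fin k → PruferGroup p)),
      Function.Injective f ∧ ∀ x, x ^ p = 1 → x ∈ f.range := by
  let := AddCommGroup.zmodModule (n := p) (G := Additive A) hA
  have : Module.Finite (ZMod p) (Additive A) := .of_finite
  let k := Module.finrank (ZMod p) (Additive A)
  let b := Module.finBasis (ZMod p) (Additive A)
  refine ⟨k, AddMonoidHom.toMultiplicativeRight
    ((AddMonoidHom.compLeft (PruferGroup.ofZMod p) (Fin k)).comp
      b.equivFun.toLinearMap.toAddMonoidHom),
    PruferGroup.ofZMod_injective.comp_left.comp b.equivFun.injective, fun x hx => ?_⟩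
  choose c hc using fun i => PruferGroup.exists_ofZMod_eq (congrFun hx i)
  refine ⟨(b.equivFun.symm c).toMul, funext fun i => ?_⟩
  exact (congrArg (fun v => PruferGroup.ofZMod p (v i))
    (b.equivFun.apply_symm_apply c)).trans (hc i)

theorem IsPTorus.exists_mulEquiv (h : IsPTorus p A) :
    ∃ k : ℕ, Nonempty (A ≃* Multiplicative (Fin k → PruferGroup p)) := by
  have : Finite (powMonoidHom p : A →* A).ker := h.finite_torsion.to_subtype
  obtain ⟨k, g, hg, hgr⟩ := exists_embedding_of_forall_pow_eq_one
    (A := (powMonoidHom p : A →* A).ker) fun a => Subtype.ext a.2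
  have hE := PruferGroup.isPTorus_pi (p := p) k
  obtain ⟨f, hf⟩ := exists_extension_of_exists_pow_eq (fun _ => hE.exists_pow_eq_of_ne_zero) _ g
  have hinj : Function.Injective f := injective_of_injOn_torsion h.isPGroup f fun a ha hfa =>
    congrArg Subtype.val ((injective_iff_map_eq_one g).mp hg ⟨a, ha⟩ ((hf _).symm.trans hfa))
  have hsurj : Function.Surjective f :=
    surjective_of_torsion_le_range h.exists_pow_eq hE.isPGroup f fun x hx => by
      obtain ⟨a, rfl⟩ := hgr x hx
      exact ⟨a, hf a⟩
  exact ⟨k, ⟨MulEquiv.ofBijective f ⟨hinj, hsurj⟩⟩⟩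

end PTori

section PowerSubgroups

variable {p : ℕ} {A : Type*} [CommGroup A]

theorem exists_pow_eq_of_torsion_le_range_pow (hA : IsPGroup p A)
    (h : ∀ a : A, a ^ p = 1 → ∀ n, ∃ b, b ^ p ^ n = a) (a : A) : ∃ b, b ^ p = a := by
  obtain ⟨r, hr⟩ := hA a
  induction r generalizing a with
  | zero => exact ⟨1, by simpa using hr.symm⟩
  | succ r ih =>
    obtain ⟨b, hb⟩ := h (a ^ p ^ r) (by rw [← pow_mul, ← pow_succ, hr]) (r + 1)
    obtain ⟨c, hc⟩ := ih (a / b ^ p) (by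
      rw [div_pow, ← pow_mul, ← pow_succ', hb, div_self'])
    exact ⟨c * b, by rw [mul_pow, hc, div_mul_cancel]⟩

theorem exists_torsion_inf_range_pow_le (hfin : {a : A | a ^ p = 1}.Finite) :
    ∃ n, ∀ a : A, a ^ p = 1 → (∃ b, b ^ p ^ n = a) → ∀ m, ∃ b, b ^ p ^ m = a := by
  have : Finite (powMonoidHom p : A →* A).ker := hfin.to_subtype
  let torsionPowers : ℕ →o (Subgroup (powMonoidHom p : A →* A).ker)ᵒᵈ :=
    { toFun n := .toDual ((powMonoidHom (p ^ n) : A →* A).range.subgroupOf _)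
      monotone' m n hmn := Subgroup.comap_mono (by
        rintro _ ⟨b, rfl⟩
        obtain ⟨c, hc⟩ := pow_dvd_pow p hmn
        exact ⟨b ^ c, by simp only [powMonoidHom_apply, hc, ← pow_mul, mul_comm]⟩) }
  obtain ⟨n, hn⟩ := WellFoundedGT.monotone_chain_condition torsionPowers
  refine ⟨n, fun a ha hb m => ?_⟩
  have hmem : (⟨a, ha⟩ : (powMonoidHom p : A →* A).ker) ∈ (torsionPowers (max n m)).ofDual :=
    hn _ (le_max_left n m) ▸ hb
  exact torsionPowers.monotone (le_max_right n m) hmem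

theorem finiteIndex_range_powMonoidHom {n : ℕ} (hfin : {a : A | a ^ n = 1}.Finite)
    (h : ∀ a : A, ∃ b, (b ^ n) ^ n = a ^ n) : (powMonoidHom n : A →* A).range.FiniteIndex := by
  rw [Subgroup.finiteIndex_iff_finite_quotient]
  have := hfin.to_subtype
  refine .of_surjective (fun a : {a : A | a ^ n = 1} =>
    (a : A ⧸ (powMonoidHom n : A →* A).range)) fun y => ?_
  obtain ⟨a, rfl⟩ := QuotientGroup.mk_surjective y
  obtain ⟨b, hb⟩ := h a
  refine ⟨⟨a / b ^ n, by rw [Set.mem_ofPred_eq, div_pow, hb, div_self']⟩, ?_⟩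
  exact QuotientGroup.eq.mpr ⟨b, by simp⟩

theorem exists_isPTorus_range_powMonoidHom [Fact p.Prime] (hA : IsPGroup p A)
    (hfin : {a : A | a ^ p = 1}.Finite) :
    ∃ n : ℕ, IsPTorus p (powMonoidHom n : A →* A).range ∧
      (powMonoidHom n : A →* A).range.FiniteIndex := by
  obtain ⟨n, hn⟩ := exists_torsion_inf_range_pow_le hfin
  have htorus : IsPTorus p (powMonoidHom (p ^ n) : A →* A).range := by
    refine ⟨hA.to_subgroup _, exists_pow_eq_of_torsion_le_range_pow (hA.to_subgroup _) ?_,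
      finite_setOf_pow_eq_one_of_injective (Subgroup.subtype_injective _) hfin⟩
    rintro ⟨a, ha⟩ hap m
    obtain ⟨b, hb⟩ := hn a (congrArg Subtype.val hap) ha (n + m)
    exact ⟨⟨b ^ p ^ n, b, rfl⟩, Subtype.ext (by simpa [← pow_mul, ← pow_add] using hb)⟩
  refine ⟨p ^ n, htorus, finiteIndex_range_powMonoidHom
    (finite_setOf_pow_pow_eq_one hfin n) fun a => ?_⟩
  obtain ⟨⟨_, b, rfl⟩, hb⟩ := htorus.exists_pow_eq_of_ne_zero
    (pow_ne_zero n (Fact.out : p.Prime).ne_zero) ⟨a ^ p ^ n, a, rfl⟩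
  exact ⟨b, congrArg Subtype.val hb⟩

end PowerSubgroups

section DiscretePToral

variable {p : ℕ} {S : Type*} [Group S] {T : Subgroup S}

theorem isPGroup_of_quotient [T.Normal] (hT : IsPGroup p T) (hST : IsPGroup p (S ⧸ T)) :
    IsPGroup p S := by
  have hS : IsPGroup p ((⊤ : Subgroup (S ⧸ T)).comap (QuotientGroup.mk' T)) :=
    (hST.to_subgroup ⊤).comap_of_ker_isPGroup _ (by rwa [QuotientGroup.ker_mk'])
  exact hS.of_equiv ((MulEquiv.subgroupCongr (Subgroup.comap_top _)).trans Subgroup.topEquiv)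

theorem IsDiscretePToral.exists_isPTorus [Fact p.Prime] (hS : IsDiscretePToral p S) :
    ∃ (T : Subgroup S) (_ : T.Normal) (_ : IsMulCommutative T) (_ : T.FiniteIndex),
      IsPGroup p S ∧ IsPTorus p T := by
  obtain ⟨k, m, T, hT, ⟨e⟩, hfin, hST, -⟩ := hS
  have hcomm : IsMulCommutative T := ⟨⟨fun a b => e.injective (by simp only [map_mul, mul_comm])⟩⟩
  have htorus : IsPTorus p T := (PruferGroup.isPTorus_pi k).of_mulEquiv e.symm
  exact ⟨T, hT, hcomm, Subgroup.finiteIndex_of_finite_quotient,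
    isPGroup_of_quotient htorus.isPGroup hST, htorus⟩

theorem hasPToralOrder_relIndex (hS : IsPGroup p S) {A C : Subgroup S} {k : ℕ} (hAC : A ≤ C)
    (hCA : C ≤ Subgroup.normalizer (A : Set S)) (hfin : A.relIndex C ≠ 0)
    (e : A ≃* Multiplicative (Fin k → PruferGroup p)) : HasPToralOrder p C k (A.relIndex C) := by
  have hnormal : (A.subgroupOf C).Normal := Subgroup.normal_subgroupOf_of_le_normalizer hCA
  have : (A.subgroupOf C).FiniteIndex := ⟨hfin⟩
  exact ⟨A.subgroupOf C, hnormal, ⟨(Subgroup.subgroupOfEquivOfLe hAC).trans e⟩, inferInstance,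
    (hS.to_subgroup C).to_quotient _, rfl⟩

theorem isMulCommutative_of_le [IsMulCommutative T] {H : Subgroup S} (hH : H ≤ T) :
    IsMulCommutative H :=
  ⟨⟨fun a b => Subtype.ext (setLike_mul_comm (hH a.2) (hH b.2))⟩⟩

variable [IsMulCommutative T]

theorem normalizer_le_normalizer_map_range_powMonoidHom (n : ℕ) :
    Subgroup.normalizer (T : Set S) ≤ Subgroup.normalizer
      ((powMonoidHom n : T →* T).range.map T.subtype : Set S) := by
  refine Subgroup.le_normalizer_iff.mpr ?_
  rintro g hg _ ⟨_, ⟨t, rfl⟩, rfl⟩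
  have hgt : g * t * g⁻¹ ∈ T := (Subgroup.mem_normalizer_iff.mp hg t).mp t.2
  exact ⟨_, ⟨⟨_, hgt⟩, rfl⟩, conj_pow⟩

theorem IsPTorus.exists_le [Fact p.Prime] (hT : IsPTorus p T) {H : Subgroup S} (hH : H ≤ T) :
    ∃ A ≤ H, ∃ _ : IsMulCommutative A, IsPTorus p A ∧ A.relIndex H ≠ 0 ∧
      Subgroup.normalizer (H : Set S) ≤ Subgroup.normalizer (A : Set S) := by
  have := isMulCommutative_of_le hH
  have hinj := Subgroup.inclusion_injective hH
  obtain ⟨n, hn, hfin⟩ := exists_isPTorus_range_powMonoidHom (hT.isPGroup.of_injective _ hinj)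
    (finite_setOf_pow_eq_one_of_injective hinj hT.finite_torsion)
  let e := (powMonoidHom n : H →* H).range.equivMapOfInjective _ H.subtype_injective
  have hle := Subgroup.map_subtype_le (powMonoidHom n : H →* H).range
  have hcomm := isMulCommutative_of_le hle
  refine ⟨_, hle, hcomm, hn.of_mulEquiv e, ?_, normalizer_le_normalizer_map_range_powMonoidHom n⟩
  rw [Subgroup.relIndex, Subgroup.subgroupOf, Subgroup.comap_map_eq_self_of_injective
    H.subtype_injective]
  exact hfin.index_ne_zero

theorem exists_hasPToralOrder [Fact p.Prime] [T.Normal] [T.FiniteIndex] (hS : IsPGroup p S)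
    (hT : IsPTorus p T) {H : Subgroup S} (hH : H ≤ T) :
    ∃ k N : ℕ, ∀ C : Subgroup S, C ⊓ T = H → ∃ m ≤ N, HasPToralOrder p C k m := by
  obtain ⟨A, hAH, _, hA, hfin, hnorm⟩ := hT.exists_le hH
  obtain ⟨k, ⟨e⟩⟩ := hA.exists_mulEquiv
  refine ⟨k, A.relIndex H * T.index, fun C hC => ?_⟩
  have hHC : H ≤ C := hC ▸ inf_le_left
  have hindex : A.relIndex C = A.relIndex H * T.relIndex C := by
    rw [← Subgroup.relIndex_mul_relIndex A H C hAH hHC, ← hC, Subgroup.inf_relIndex_left]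
  have hCH : C ≤ Subgroup.normalizer (H : Set S) := by
    have : (H.subgroupOf C).Normal := by
      rw [← hC, Subgroup.inf_subgroupOf_left]; infer_instance
    exact Subgroup.le_normalizer_of_normal_subgroupOf hHC
  refine ⟨A.relIndex C, ?_, hasPToralOrder_relIndex hS (hAH.trans hHC) (hCH.trans hnorm) ?_ e⟩
  · rw [hindex]
    gcongr
    exact Nat.le_of_dvd (Nat.pos_of_ne_zero Subgroup.FiniteIndex.index_ne_zero)
      (Subgroup.relIndex_dvd_index_of_normal T C)
  · rw [hindex]
    exact mul_ne_zero hfin (Subgroup.FiniteIndex.index_ne_zero (H := T.subgroupOf C))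

end DiscretePToral

section Centralizers

variable {S : Type*} [Group S] {T : Subgroup S}

theorem centralizer_sup_inf_right [IsMulCommutative T] (P : Subgroup S) :
    Subgroup.centralizer ((P ⊔ T : Subgroup S) : Set S) ⊓ T =
      Subgroup.centralizer (P : Set S) ⊓ T := by
  refine le_antisymm (inf_le_inf_right T (Subgroup.centralizer_le (SetLike.coe_mono le_sup_left)))
    (le_inf (Subgroup.le_centralizer_iff.mp (sup_le ?_ ?_)) inf_le_right)
  · exact Subgroup.le_centralizer_iff.mp inf_le_left
  · exact T.le_centralizer.trans (Subgroup.centralizer_le inf_le_right)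

theorem finite_range_centralizer_inf [T.Normal] [IsMulCommutative T] [T.FiniteIndex] :
    (Set.range fun P : Subgroup S => Subgroup.centralizer (P : Set S) ⊓ T).Finite := by
  refine (Set.finite_range fun Q : Subgroup (S ⧸ T) =>
    Subgroup.centralizer (Q.comap (QuotientGroup.mk' T) : Set S) ⊓ T).subset ?_
  rintro _ ⟨P, rfl⟩
  refine ⟨P.map (QuotientGroup.mk' T), ?_⟩
  simp only [Subgroup.comap_map_eq, QuotientGroup.ker_mk', centralizer_sup_inf_right]

end Centralizers

namespace FusionSystem

section Morphisms

variable {S : Type*} [Group S] (F : FusionSystem S) {P Q : Subgroup S}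

theorem inclusion_mem_hom (h : P ≤ Q) : Subgroup.inclusion h ∈ F.Hom P Q :=
  F.conj_mem _ ⟨1, fun x => by simp⟩

theorem subtype_mem_homS (P : Subgroup S) : P.subtype ∈ F.HomS P :=
  F.inclusion_mem_hom le_top

theorem subtype_comp_mem_homS {φ : P →* Q} (h : φ ∈ F.Hom P Q) : Q.subtype.comp φ ∈ F.HomS P :=
  F.comp_mem h (F.subtype_mem_homS Q)

theorem injective_of_mem_homS {φ : P →* S} (h : φ ∈ F.HomS P) : Function.Injective φ :=
  fun _ _ hxy => F.injective h (congrArg (Subgroup.topEquiv (G := S)).symm hxy)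

theorem exists_iso_of_mem_homS {φ : P →* S} (h : φ ∈ F.HomS P) (hQ : φ.range = Q) :
    ∃ e ∈ F.Iso P Q, ∀ x, (e x : S) = φ x := by
  obtain ⟨R, hR, e, he, he', hφ⟩ := F.factor h
  have hφe : ∀ x, φ x = e x := fun x => congrArg Subtype.val (DFunLike.congr_fun hφ x)
  obtain rfl : Q = R := by
    obtain rfl : φ = R.subtype.comp e.toMonoidHom := MonoidHom.ext hφe
    rw [← hQ, MonoidHom.range_comp, MonoidHom.range_eq_top.mpr e.surjective,
      ← MonoidHom.range_eq_map, R.range_subtype]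
  exact ⟨e, ⟨he, he'⟩, fun x => (hφe x).symm⟩

theorem restrict_mem_homS {φ : P →* S} (h : φ ∈ F.HomS P) (hQ : Q ≤ P) :
    φ.comp (Subgroup.inclusion hQ) ∈ F.HomS Q :=
  F.comp_mem (F.inclusion_mem_hom hQ) h

theorem exists_inverse_mem_homS {φ : P →* S} (h : φ ∈ F.HomS P) :
    ∃ ψ ∈ F.HomS φ.range, ∀ x, ψ (φ.rangeRestrict x) = x := by
  obtain ⟨e, he, hφ⟩ := F.exists_iso_of_mem_homS h rfl
  refine ⟨_, F.subtype_comp_mem_homS he.2, fun x => ?_⟩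
  rw [← show e x = φ.rangeRestrict x from Subtype.ext (hφ x)]
  simp

end Morphisms

section Extensions

variable {p : ℕ} {S : Type*} [Group S] {T : Subgroup S} (F : FusionSystem S)

/-- The extension axiom for saturated fusion systems: every morphism `φ` with fully centralized
image extends to `N_φ`. -/
def HasExtensions (p : ℕ) : Prop :=
  ∀ (P : Subgroup S) (φ : P →* S), φ ∈ F.HomS P → F.FullyCentralized p φ.range →
    ∃ ψ ∈ F.HomS (extender φ), ψ.comp (Subgroup.inclusion (le_extender φ)) = φ

/-- The morphism `e` on `P` serves as a target for all `F`-conjugates of `P`: for each morphism `f`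
on `P`, the isomorphism `e ∘ f⁻¹` on `f(P)` extends over the centralizer of `f(P)`. -/
def ExtendsOverCentralizers {P : Subgroup S} (e : P →* S) : Prop :=
  ∀ f ∈ F.HomS P, ∃ Q : Subgroup S, f.range ≤ Q ∧ Subgroup.centralizer (f.range : Set S) ≤ Q ∧
    ∃ ψ ∈ F.HomS Q, ∀ x (h : f x ∈ Q), ψ ⟨f x, h⟩ = e x

theorem centralizer_le_extender {P : Subgroup S} (φ : P →* S) :
    Subgroup.centralizer (P : Set S) ≤ extender φ := by
  refine fun g hg => ⟨Subgroup.centralizer_le_normalizer _ hg, 1, fun x y hxy => ?_⟩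
  have hgx : g * x * g⁻¹ = x := by
    rw [← Subgroup.mem_centralizer_iff.mp hg x x.2, mul_inv_cancel_right]
  rw [Subtype.ext (hxy.trans hgx), one_mul, inv_one, mul_one]

variable [T.Normal] [IsMulCommutative T] [T.FiniteIndex]

/- Since there are only finitely many intersections `C_S(Q) ∩ T`, and each of them leaves finitely
many possibilities for the order of `C_S(Q)`, some conjugate of `P` has maximal order. -/
theorem exists_fullyCentralized [Fact p.Prime] (hS : IsPGroup p S) (hT : IsPTorus p T)
    (P : Subgroup S) : ∃ Q : Subgroup S, F.IsConjugate P Q ∧ F.FullyCentralized p Q := by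
  choose! k N hkN using fun H (hH : H ≤ T) => exists_hasPToralOrder hS hT hH
  choose m hmN hm using fun Q : Subgroup S =>
    hkN (Subgroup.centralizer (Q : Set S) ⊓ T) inf_le_right _ rfl
  let order (Q : Subgroup S) : ℕ × ℕ := (k (Subgroup.centralizer (Q : Set S) ⊓ T), m Q)
  have horders : (Set.range order).Finite := by
    refine (finite_range_centralizer_inf (T := T)).biUnion (t := fun H => {k H} ×ˢ Set.Iic (N H))
      (fun H _ => (Set.finite_singleton _).prod (Set.finite_Iic _)) |>.subset ?_
    rintro _ ⟨Q, rfl⟩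
    exact Set.mem_biUnion (Set.mem_range_self Q) ⟨rfl, hmN Q⟩
  obtain ⟨_, ⟨Q, hQ, rfl⟩, hmax⟩ := Set.exists_max_image (order '' {Q | F.IsConjugate P Q}) toLex
    (horders.subset (Set.image_subset_range _ _)) ⟨_, P, ⟨1, (F.aut P).one_mem⟩, rfl⟩
  refine ⟨Q, hQ, fun Q' ⟨e', he'⟩ => ?_⟩
  obtain ⟨e, he⟩ := id hQ
  have hPQ' : F.IsConjugate P Q' := ⟨e.trans e', F.comp_mem he.1 he'.1, F.comp_mem he'.2 he.2⟩
  exact ⟨_, _, _, _, hm Q', hm Q, Prod.Lex.toLex_le_toLex.mp (hmax _ ⟨Q', hPQ', rfl⟩)⟩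

theorem HasExtensions.exists_extendsOverCentralizers [Fact p.Prime] {F : FusionSystem S}
    (hF : F.HasExtensions p) (hS : IsPGroup p S) (hT : IsPTorus p T) (P : Subgroup S) :
    ∃ e : P →* S, F.ExtendsOverCentralizers e := by
  obtain ⟨R, ⟨e, he⟩, hR⟩ := F.exists_fullyCentralized hS hT P
  refine ⟨R.subtype.comp e.toMonoidHom, fun f hf => ?_⟩
  obtain ⟨i, hi, hfi⟩ := F.exists_iso_of_mem_homS hf rfl
  let φ : f.range →* S := R.subtype.comp (i.symm.trans e).toMonoidHom
  have hφ : φ ∈ F.HomS f.range := F.subtype_comp_mem_homS (F.comp_mem hi.2 he.1)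
  have hrange : φ.range = R := by
    rw [MonoidHom.range_comp, MonoidHom.range_eq_top.mpr (i.symm.trans e).surjective,
      ← MonoidHom.range_eq_map, R.range_subtype]
  obtain ⟨ψ, hψ, hψφ⟩ := hF f.range φ hφ (hrange.symm ▸ hR)
  refine ⟨extender φ, le_extender φ, centralizer_le_extender φ, ψ, hψ, fun x h => ?_⟩
  calc ψ ⟨f x, h⟩ = φ (f.rangeRestrict x) := DFunLike.congr_fun hψφ (f.rangeRestrict x)
    _ = φ (i x) := congrArg φ (Subtype.ext (hfi x).symm)
    _ = e x := congrArg (fun y => (e y : S)) (i.symm_apply_apply x)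

end Extensions

section Torus

variable {p : ℕ} {S : Type*} [Group S] {T : Subgroup S} [T.Normal] {F : FusionSystem S}

theorem conjNormal_mem_aut (x : S) : (MulAut.conjNormal x : MulAut T) ∈ F.aut T :=
  ⟨F.conj_mem _ ⟨x, fun t => by simp⟩, F.conj_mem _ ⟨x⁻¹, fun t => by
    rw [inv_inv]
    exact MulAut.conjNormal_symm_apply x t⟩⟩

theorem map_mem_of_divisible {D : Type*} [Group D] (hD : ∀ d : D, ∃ c, c ^ T.index = d)
    (ψ : D →* S) (d : D) : ψ d ∈ T := by
  obtain ⟨c, rfl⟩ := hD d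
  rw [map_pow]
  exact T.pow_index_mem _

variable [IsMulCommutative T] [T.FiniteIndex] [Fact p.Prime]

theorem range_eq_of_mem_homS (hT : IsPTorus p T) {φ : T →* S} (hφ : φ ∈ F.HomS T) :
    φ.range = T := by
  have hmem := map_mem_of_divisible (hT.exists_pow_eq_of_ne_zero T.index_ne_zero_of_finite) φ
  refine le_antisymm (by rintro _ ⟨t, rfl⟩; exact hmem t) fun s hs => ?_
  have hinj : Function.Injective (φ.codRestrict T hmem) := fun x y hxy =>
    F.injective_of_mem_homS hφ (congrArg Subtype.val hxy)
  obtain ⟨t, ht⟩ := hT.surjective_of_injective _ hinj ⟨s, hs⟩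
  exact ⟨t, congrArg Subtype.val ht⟩

theorem exists_aut_of_mem_homS (hT : IsPTorus p T) {Q : Subgroup S} {ψ : Q →* S}
    (hψ : ψ ∈ F.HomS Q) (hTQ : T ≤ Q) : ∃ w ∈ F.aut T, ∀ t : T, (w t : S) = ψ ⟨t, hTQ t.2⟩ :=
  have hψT := F.restrict_mem_homS hψ hTQ
  F.exists_iso_of_mem_homS hψT (range_eq_of_mem_homS hT hψT)

theorem fullyNormalized_of_isPTorus (hS : IsPGroup p S) (hT : IsPTorus p T) :
    F.FullyNormalized p T := by
  rintro T' ⟨e, he⟩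
  obtain rfl : T' = T := by
    rw [← range_eq_of_mem_homS hT (F.subtype_comp_mem_homS he.1), MonoidHom.range_comp,
      MonoidHom.range_eq_top.mpr e.surjective, ← MonoidHom.range_eq_map, T'.range_subtype]
  obtain ⟨k, N, hkN⟩ := exists_hasPToralOrder hS hT (H := Subgroup.normalizer (T' : Set S) ⊓ T')
    inf_le_right
  obtain ⟨m, -, hm⟩ := hkN _ rfl
  exact ⟨k, m, k, m, hm, hm, Or.inr ⟨rfl, le_rfl⟩⟩

theorem IsSaturated.finite_aut (hF : F.IsSaturated p) (hS : IsPGroup p S) (hT : IsPTorus p T) :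
    Finite (F.aut T) := by
  have : Finite (F.Out T) := (hF.sylow T (fullyNormalized_of_isPTorus hS hT)).2.1
  have hconj : (MulAut.conj : T →* MulAut T) = 1 := by
    ext t x
    simp [mul_comm t x]
  have hInn : (MulAut.conj : T →* MulAut T).range.subgroupOf (F.aut T) = ⊥ := by
    rw [hconj, MonoidHom.range_one, Subgroup.bot_subgroupOf]
  exact .of_equiv _ ((QuotientGroup.quotientMulEquivOfEq hInn).trans
    QuotientGroup.quotientBot).toEquiv

theorem ExtendsOverCentralizers.exists_aut (hT : IsPTorus p T) {P : Subgroup S} {e f : P →* S}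
    (he : F.ExtendsOverCentralizers e) (hf : f ∈ F.HomS P) (hfT : ∀ x, f x ∈ T) :
    ∃ w ∈ F.aut T, ∀ x, (w ⟨f x, hfT x⟩ : S) = e x := by
  obtain ⟨Q, -, hQ, ψ, hψ, hψe⟩ := he f hf
  have hrange : f.range ≤ T := by rintro _ ⟨x, rfl⟩; exact hfT x
  have hTQ : T ≤ Q := T.le_centralizer.trans ((Subgroup.centralizer_le hrange).trans hQ)
  obtain ⟨w, hw, hwψ⟩ := exists_aut_of_mem_homS hT hψ hTQ
  exact ⟨w, hw, fun x => (hwψ _).trans (hψe x (hTQ (hfT x)))⟩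

theorem HasExtensions.exists_aut_eq (hF : F.HasExtensions p) (hS : IsPGroup p S)
    (hT : IsPTorus p T) {P : Subgroup S} (hP : P ≤ T) {f : P →* S} (hf : f ∈ F.HomS P)
    (hfT : ∀ x, f x ∈ T) : ∃ w ∈ F.aut T, ∀ x : P, (w ⟨x, hP x.2⟩ : S) = f x := by
  obtain ⟨e, he⟩ := hF.exists_extendsOverCentralizers hS hT P
  obtain ⟨w₁, hw₁, h₁⟩ := he.exists_aut hT (F.subtype_mem_homS P) fun x => hP x.2
  obtain ⟨w₂, hw₂, h₂⟩ := he.exists_aut hT hf hfT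
  refine ⟨w₂⁻¹ * w₁, mul_mem (inv_mem hw₂) hw₁, fun x => ?_⟩
  have h₁₂ : w₁ ⟨x, hP x.2⟩ = w₂ ⟨f x, hfT x⟩ := Subtype.ext ((h₁ x).trans (h₂ x).symm)
  rw [MulAut.mul_apply, h₁₂, MulAut.inv_apply_self]

theorem HasExtensions.exists_map_eq_aut_apply (hF : F.HasExtensions p) (hS : IsPGroup p S)
    (hT : IsPTorus p T) {P : Subgroup S} {f : P →* S} (hf : f ∈ F.HomS P) {x : P} {z : T}
    (hz : f x = z) : ∃ w ∈ F.aut T, ∃ ψ ∈ F.HomS (Subgroup.centralizer {(x : S)}),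
      ∀ h, ψ ⟨x, h⟩ = w z := by
  let x' : Subgroup.zpowers (x : S) := ⟨x, Subgroup.mem_zpowers _⟩
  have hxP : Subgroup.zpowers (x : S) ≤ P := Subgroup.zpowers_le.mpr x.2
  obtain ⟨e, he⟩ := hF.exists_extendsOverCentralizers hS hT (Subgroup.zpowers (x : S))
  have hfT : ∀ y, f.comp (Subgroup.inclusion hxP) y ∈ T := by
    rintro ⟨_, n, rfl⟩
    rw [MonoidHom.comp_apply, show Subgroup.inclusion hxP ⟨(x : S) ^ n, n, rfl⟩ = x ^ n from rfl,
      map_zpow, hz]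
    exact zpow_mem z.2 n
  obtain ⟨w, hw, hwe⟩ := he.exists_aut hT (F.restrict_mem_homS hf hxP) hfT
  obtain ⟨Q, -, hQ, ψ, hψ, hψe⟩ := he _ (F.subtype_mem_homS _)
  have hxQ : Subgroup.centralizer {(x : S)} ≤ Q := by
    rwa [Subgroup.range_subtype, Subgroup.zpowers_eq_closure, Subgroup.centralizer_closure] at hQ
  refine ⟨w, hw, _, F.restrict_mem_homS hψ hxQ, fun h => ?_⟩
  calc ψ ⟨x, hxQ h⟩ = e x' := hψe x' (hxQ h)
    _ = w z := (hwe x').symm.trans (congrArg (fun t => (w t : S)) (Subtype.ext hz))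

end Torus

end FusionSystem

section CyclicNorm

variable {A : Type*} [CommGroup A] {α : MulAut A} {a : A}

/-- The norm `a ↦ a · α(a) ⋯ αⁿ⁻¹(a)` of the cyclic group generated by an automorphism `α` with
`α ^ n = 1`. -/
def cyclicNorm (n : ℕ) (α : MulAut A) : A →* A := ∏ i ∈ Finset.range n, (α ^ i).toMonoidHom

theorem cyclicNorm_apply (n : ℕ) (α : MulAut A) (a : A) :
    cyclicNorm n α a = ∏ i ∈ Finset.range n, (α ^ i) a := by
  simp [cyclicNorm, MonoidHom.finsetProd_apply]

theorem cyclicNorm_apply_of_fixed (n : ℕ) (ha : α a = a) : cyclicNorm n α a = a ^ n := by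
  have hfix : ∀ i : ℕ, (α ^ i) a = a := fun i => by
    induction i with
    | zero => rfl
    | succ i ih => rw [pow_succ, MulAut.mul_apply, ha, ih]
  simp only [cyclicNorm_apply, hfix, Finset.prod_const, Finset.card_range]

theorem apply_cyclicNorm {n : ℕ} (hα : α ^ n = 1) (a : A) :
    α (cyclicNorm n α a) = cyclicNorm n α a := by
  have hshift := Finset.prod_range_succ' (fun i => (α ^ i) a) n
  rw [Finset.prod_range_succ, hα, pow_zero, mul_left_inj] at hshift
  simp only [cyclicNorm_apply, map_prod, ← MulAut.mul_apply, ← pow_succ', ← hshift]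

variable {S : Type*} [Group S] {T : Subgroup S} [T.Normal] [IsMulCommutative T]

theorem conjNormal_eq_one_of_mem {s : S} (hs : s ∈ T) : (MulAut.conjNormal s : MulAut T) = 1 := by
  ext t
  rw [MulAut.conjNormal_apply, setLike_mul_comm hs t.2, mul_inv_cancel_right, MulAut.one_apply]

theorem cyclicNorm_conjNormal_mem_centralizer (x : S) (t : T) :
    ((cyclicNorm T.index (MulAut.conjNormal x) : T →* T) t : S) ∈ Subgroup.centralizer {x} := by
  have hα : (MulAut.conjNormal x : MulAut T) ^ T.index = 1 := by
    rw [← map_pow, conjNormal_eq_one_of_mem (T.pow_index_mem x)]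
  have hfix := congrArg Subtype.val (apply_cyclicNorm hα t)
  rw [MulAut.conjNormal_apply, mul_inv_eq_iff_eq_mul] at hfix
  exact Subgroup.mem_centralizer_singleton_iff.mpr hfix.symm

theorem cyclicNorm_conjNormal_pow_index (x : S) :
    ((cyclicNorm T.index (MulAut.conjNormal x) : T →* T) ⟨x ^ T.index, T.pow_index_mem x⟩ : S) =
      x ^ (T.index * T.index) := by
  rw [cyclicNorm_apply_of_fixed _ (Subtype.ext ?_), Subgroup.coe_pow, pow_mul]
  rw [MulAut.conjNormal_apply, ← pow_succ', pow_succ, mul_inv_cancel_right]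

end CyclicNorm

namespace FusionSystem

variable {p : ℕ} [Fact p.Prime] {S : Type*} [Group S] {T : Subgroup S} [T.Normal]
  [IsMulCommutative T] [T.FiniteIndex] {F : FusionSystem S}

theorem HasExtensions.exists_notMem_range_cyclicNorm (hF : F.HasExtensions p) (hS : IsPGroup p S)
    (hT : IsPTorus p T) {P : Subgroup S} {f : P →* S} (hf : f ∈ F.HomS P) {x : P}
    (hx : (x : S) ∉ T) {z : T} (hz : f x = z) :
    ∃ w ∈ F.aut T, ∃ α ∈ F.aut T, w z ∉ (cyclicNorm T.index α).range ∧
      w z ^ (T.index * T.index) ∈ (cyclicNorm T.index α).range := by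
  obtain ⟨w₁, hw₁, ψ, hψ, hψx⟩ := hF.exists_map_eq_aut_apply hS hT hf hz
  have hxC : (x : S) ∈ Subgroup.centralizer {(x : S)} :=
    Subgroup.mem_centralizer_singleton_iff.mpr rfl
  let norm : T →* T := cyclicNorm T.index (MulAut.conjNormal (x : S))
  let D : Subgroup S := norm.range.map T.subtype
  have hDC : D ≤ Subgroup.centralizer {(x : S)} := by
    rintro _ ⟨_, ⟨t, rfl⟩, rfl⟩
    exact cyclicNorm_conjNormal_mem_centralizer _ t
  have hD : ∀ d : D, ∃ c, c ^ T.index = d := by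
    rintro ⟨_, _, ⟨t, rfl⟩, rfl⟩
    obtain ⟨c, rfl⟩ := hT.exists_pow_eq_of_ne_zero T.index_ne_zero_of_finite t
    exact ⟨⟨norm c, _, ⟨c, rfl⟩, rfl⟩, Subtype.ext (by simp)⟩
  obtain ⟨w₂, hw₂, h₂⟩ := hF.exists_aut_eq hS hT (T.map_subtype_le _)
    (F.restrict_mem_homS hψ hDC) (map_mem_of_divisible hD _)
  have hnorm : ∀ t h, (w₂ (norm t) : S) = ψ ⟨norm t, h⟩ := fun t _ =>
    h₂ ⟨norm t, _, ⟨t, rfl⟩, rfl⟩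
  refine ⟨w₂⁻¹ * w₁, mul_mem (inv_mem hw₂) hw₁, _, conjNormal_mem_aut (x : S), ?_, ?_⟩
  · rintro ⟨t, ht⟩
    have hψt : ψ ⟨norm t, cyclicNorm_conjNormal_mem_centralizer _ t⟩ = ψ ⟨x, hxC⟩ := by
      rw [← hnorm, hψx, show norm t = _ from ht, MulAut.mul_apply, MulAut.apply_inv_self]
    have hxt := congrArg Subtype.val (F.injective_of_mem_homS hψ hψt)
    exact hx (hxt ▸ (norm t).2)
  · have hpow := cyclicNorm_conjNormal_pow_index (T := T) (x : S)
    have hw : w₂ (norm ⟨x ^ T.index, T.pow_index_mem _⟩) = w₁ z ^ (T.index * T.index) := by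
      refine Subtype.ext ?_
      rw [hnorm _ (hpow ▸ pow_mem hxC _), Subgroup.coe_pow, ← hψx hxC, ← map_pow]
      exact congrArg ψ (Subtype.ext hpow)
    refine ⟨⟨x ^ T.index, T.pow_index_mem _⟩, ?_⟩
    rw [MulAut.mul_apply, ← map_pow, ← hw, MulAut.inv_apply_self]

end FusionSystem

section Characters

variable {A : Type*} [CommGroup A]

theorem exists_circle_pow_eq {n : ℕ} (hn : n ≠ 0) (z : Circle) : ∃ w, w ^ n = z :=
  ⟨Circle.exp (Complex.arg z / n), by
    rw [← Circle.exp_nsmul, nsmul_eq_mul, mul_div_cancel₀ _ (Nat.cast_ne_zero.mpr hn),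
      Circle.exp_arg]⟩

theorem exists_character_ne_one_of_finite [Finite A] {a : A} (ha : a ≠ 1) :
    ∃ χ : A →* Circle, χ a ≠ 1 := by
  obtain ⟨ψ, hψ⟩ := AddChar.exists_apply_ne_zero (α := Additive A) (a := .ofMul a) |>.mpr ha
  refine ⟨(AddChar.circleEquivComplex.symm ψ).toMonoidHom, fun h => hψ ?_⟩
  rw [← AddChar.circleEquivComplex.apply_symm_apply ψ]
  exact Circle.coe_eq_one.mpr h

theorem exists_character_ne_one {a : A} (hfin : IsOfFinOrder a) (ha : a ≠ 1) :
    ∃ χ : A →* Circle, χ a ≠ 1 := by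
  have := hfin.finite_zpowers.to_subtype
  obtain ⟨g, hg⟩ := exists_character_ne_one_of_finite
    (a := (⟨a, Subgroup.mem_zpowers a⟩ : Subgroup.zpowers a)) (by simpa using ha)
  obtain ⟨χ, hχ⟩ := exists_extension_of_exists_pow_eq (fun _ => exists_circle_pow_eq) _ g
  exact ⟨χ, by rwa [hχ ⟨a, _⟩]⟩

theorem exists_character_ne_one_of_notMem {D : Subgroup A} {a : A} {n : ℕ} (hn : n ≠ 0)
    (ha : a ∉ D) (haD : a ^ n ∈ D) : ∃ χ : A →* Circle, (∀ d ∈ D, χ d = 1) ∧ χ a ≠ 1 := by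
  obtain ⟨χ, hχ⟩ := exists_character_ne_one (a := (a : A ⧸ D))
    (isOfFinOrder_iff_pow_eq_one.mpr
      ⟨n, Nat.pos_of_ne_zero hn, (QuotientGroup.eq_one_iff (a ^ n)).mpr haD⟩)
    (mt (QuotientGroup.eq_one_iff a).mp ha)
  refine ⟨χ.comp (QuotientGroup.mk' D), fun d hd => ?_, hχ⟩
  rw [MonoidHom.comp_apply, QuotientGroup.mk'_apply, (QuotientGroup.eq_one_iff d).mpr hd, map_one]

theorem exists_finite_separating_characters {n : ℕ} (hn : n ≠ 0) (hfin : {a : A | a ^ n = 1}.Finite)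
    {𝒟 : Set (Subgroup A)} (h𝒟 : 𝒟.Finite) (hdiv : ∀ D ∈ 𝒟, ∀ d ∈ D, ∃ c ∈ D, c ^ n = d) :
    ∃ L : Set (A →* Circle), L.Finite ∧
      ∀ D ∈ 𝒟, ∀ a ∉ D, a ^ n ∈ D → ∃ χ ∈ L, χ a ≠ 1 ∧ χ a ^ n = 1 := by
  choose! χ hχ hχ' using fun (x : Subgroup A × A) (hx : x.2 ∉ x.1 ∧ x.2 ^ n ∈ x.1) =>
    exists_character_ne_one_of_notMem hn hx.1 hx.2
  refine ⟨χ '' (𝒟 ×ˢ {a : A | a ^ n = 1}), (h𝒟.prod hfin).image χ, fun D hD a ha haD => ?_⟩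
  obtain ⟨d, hd, hda⟩ := hdiv D hD _ haD
  have htor : (a * d⁻¹) ^ n = 1 := by rw [mul_pow, inv_pow, hda, mul_inv_cancel]
  have hsep : a * d⁻¹ ∉ D ∧ (a * d⁻¹) ^ n ∈ D :=
    ⟨fun h => ha (by simpa using mul_mem h hd), htor ▸ one_mem D⟩
  refine ⟨_, ⟨(D, a * d⁻¹), ⟨hD, htor⟩, rfl⟩, ?_, ?_⟩
  · simpa [hχ (D, a * d⁻¹) hsep d hd] using hχ' (D, a * d⁻¹) hsep
  · rw [← map_pow, hχ (D, a * d⁻¹) hsep _ haD]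

theorem eq_one_of_forall_character_eq_one {p n : ℕ} (hA : IsPGroup p A) (hpn : p ∣ n)
    {L : Set (A →* Circle)} (hL : ∀ a : A, a ≠ 1 → a ^ n = 1 → ∃ χ ∈ L, χ a ≠ 1) {a : A}
    (ha : ∀ χ ∈ L, χ a = 1) : a = 1 := by
  have hroot : ∀ b : A, b ^ p = 1 → (∀ χ ∈ L, χ b = 1) → b = 1 := fun b hb hbL => by
    by_contra hne
    obtain ⟨c, rfl⟩ := hpn
    obtain ⟨χ, hχ, hχb⟩ := hL b hne (by rw [pow_mul, hb, one_pow])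
    exact hχb (hbL χ hχ)
  obtain ⟨m, hm⟩ := hA a
  induction m generalizing a with
  | zero => simpa using hm
  | succ m ih =>
    exact hroot a (ih (fun χ hχ => by rw [map_pow, ha χ hχ, one_pow])
      (by rw [← pow_mul, ← pow_succ', hm])) ha

/-- The monomials `∏ χₖ ^ gₖ` with `0 ≤ gₖ < n` in the characters `χₖ`: the constituents of the
tensor product over `k` of the representations `1 ⊕ χₖ ⊕ ⋯ ⊕ χₖ ^ (n - 1)`. -/
noncomputable def monomialCharacter {K : Type*} [Fintype K] (χ : K → A →* Circle) (n : ℕ)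
    (g : K → Fin n) : A →* Circle :=
  ∏ k, χ k ^ (g k : ℕ)

section Monomials

variable {K : Type*} [Fintype K] (χ : K → A →* Circle) {n : ℕ}

theorem monomialCharacter_apply (g : K → Fin n) (a : A) :
    monomialCharacter χ n g a = ∏ k, χ k a ^ (g k : ℕ) := by
  simp [monomialCharacter, MonoidHom.finsetProd_apply]

theorem monomialCharacter_single [DecidableEq K] (hn : 1 < n) (k : K) [NeZero n] (a : A) :
    monomialCharacter χ n (Pi.single k ⟨1, hn⟩) a = χ k a := by
  rw [monomialCharacter_apply, Fintype.prod_eq_single k fun l hl => by simp [hl]]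
  simp

variable [DecidableEq K]

theorem sum_monomialCharacter (a : A) :
    ∑ g, (monomialCharacter χ n g a : ℂ) = ∏ k, ∑ i ∈ Finset.range n, (χ k a : ℂ) ^ i := by
  simp_rw [← Fin.sum_univ_eq_sum_range, Fintype.prod_sum]
  refine Finset.sum_congr rfl fun g _ => ?_
  rw [monomialCharacter_apply]
  exact (map_prod Circle.coeHom _ _).trans (Finset.prod_congr rfl fun k _ => Circle.coe_pow _ _)

theorem sum_monomialCharacter_eq_zero {k : K} {a : A} (ha : χ k a ≠ 1) (han : χ k a ^ n = 1) :
    ∑ g, (monomialCharacter χ n g a : ℂ) = 0 := by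
  rw [sum_monomialCharacter]
  refine Finset.prod_eq_zero (Finset.mem_univ k) ?_
  rw [geom_sum_eq (mt Circle.coe_eq_one.mp ha), ← Circle.coe_pow, han, Circle.coe_one, sub_self,
    zero_div]

theorem sum_monomialCharacter_apply_eq_of_perm {a b : A} (π : Equiv.Perm K)
    (hπ : ∀ k, χ k b = χ (π k) a) :
    ∑ g, (monomialCharacter χ n g b : ℂ) = ∑ g, (monomialCharacter χ n g a : ℂ) := by
  simp_rw [sum_monomialCharacter, hπ]
  exact Equiv.prod_comp π fun k => ∑ i ∈ Finset.range n, (χ k a : ℂ) ^ i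

end Monomials

theorem exists_invariant_family_characters.{u} {A : Type u} [CommGroup A] (W : Subgroup (MulAut A))
    [Finite W] {L : Set (A →* Circle)} (hL : L.Finite) {n : ℕ} (hn : 1 < n) :
    ∃ (I : Type u) (_ : Fintype I) (_ : Nonempty I) (θ : I → A →* Circle),
      (∀ w ∈ W, ∀ a, ∑ i, (θ i (w a) : ℂ) = ∑ i, (θ i a : ℂ)) ∧
      (∀ χ ∈ L, ∀ a, χ a ≠ 1 → χ a ^ n = 1 → ∑ i, (θ i a : ℂ) = 0) ∧
      ∀ a, (∀ i, θ i a = 1) → ∀ χ ∈ L, χ a = 1 := by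
  classical
  cases nonempty_fintype W
  have := hL.fintype
  have : NeZero n := ⟨by lia⟩
  let translate : W × L → A →* Circle := fun x =>
    (x.2 : A →* Circle).comp (x.1 : MulAut A).toMonoidHom
  refine ⟨W × L → Fin n, inferInstance, inferInstance, monomialCharacter translate n,
    fun w hw a => ?_, fun χ hχ a ha han => ?_, fun a ha χ hχ => ?_⟩
  · exact sum_monomialCharacter_apply_eq_of_perm _
      ((Equiv.mulRight ⟨w, hw⟩).prodCongr (.refl L)) fun _ => rfl
  · exact sum_monomialCharacter_eq_zero translate (k := (1, ⟨χ, hχ⟩)) ha han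
  · exact (monomialCharacter_single translate hn (1, ⟨χ, hχ⟩) a).symm.trans (ha _)

theorem IsPTorus.exists_vanishing_characters.{u} {p : ℕ} [Fact p.Prime] {A : Type u} [CommGroup A]
    (hA : IsPTorus p A) (W : Subgroup (MulAut A)) [Finite W] {𝒟 : Set (Subgroup A)}
    (h𝒟 : 𝒟.Finite) (hdiv : ∀ D ∈ 𝒟, ∀ n ≠ 0, ∀ d ∈ D, ∃ c ∈ D, c ^ n = d) {m : ℕ} (hm : m ≠ 0) :
    ∃ (I : Type u) (_ : Fintype I) (_ : Nonempty I) (θ : I → A →* Circle),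
      (∀ w ∈ W, ∀ a, ∑ i, (θ i (w a) : ℂ) = ∑ i, (θ i a : ℂ)) ∧
      (∀ D ∈ 𝒟, ∀ a ∉ D, a ^ m ∈ D → ∑ i, (θ i a : ℂ) = 0) ∧
      ∀ a, (∀ i, θ i a = 1) → a = 1 := by
  have hn : 1 < p * m := lt_of_lt_of_le (Fact.out : p.Prime).one_lt
    (Nat.le_mul_of_pos_right p (Nat.pos_of_ne_zero hm))
  have hdiv' : ∀ D ∈ insert ⊥ 𝒟, ∀ d ∈ D, ∃ c ∈ D, c ^ (p * m) = d := by
    rintro D (rfl | hD) d hd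
    · exact ⟨1, one_mem _, (one_pow _).trans (Subgroup.mem_bot.mp hd).symm⟩
    · exact hdiv D hD _ (by lia) d hd
  obtain ⟨L, hL, hsep⟩ := exists_finite_separating_characters (by lia)
    (hA.finite_setOf_pow_eq_one (by lia)) (h𝒟.insert ⊥) hdiv'
  obtain ⟨I, hI, hI', θ, hinv, hvan, hone⟩ := exists_invariant_family_characters W hL hn
  refine ⟨I, hI, hI', θ, hinv, fun D hD a ha haD => ?_, fun a ha => ?_⟩
  · obtain ⟨χ, hχ, hχa, hχn⟩ := hsep D (.inr hD) a ha (pow_mul' a p m ▸ pow_mem haD p)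
    exact hvan χ hχ a hχa hχn
  · refine eq_one_of_forall_character_eq_one hA.isPGroup (dvd_mul_right p m) (fun b hb hbn => ?_)
      (hone a ha)
    obtain ⟨χ, hχ, hχb, -⟩ := hsep ⊥ (.inl rfl) b hb (Subgroup.mem_bot.mpr hbn)
    exact ⟨χ, hχ, hχb⟩

end Characters

namespace FusionSystem

theorem HasExtensions.exists_vanishing_characters.{u} {p : ℕ} [Fact p.Prime] {S : Type u} [Group S]
    {T : Subgroup S} [T.Normal] [IsMulCommutative T] [T.FiniteIndex] {F : FusionSystem S}
    [Finite (F.aut T)] (hF : F.HasExtensions p) (hS : IsPGroup p S) (hT : IsPTorus p T) :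
    ∃ (I : Type u) (_ : Fintype I) (_ : Nonempty I) (θ : I → T →* Circle),
      (∀ w ∈ F.aut T, ∀ t, ∑ i, (θ i (w t) : ℂ) = ∑ i, (θ i t : ℂ)) ∧
      (∀ P, ∀ f ∈ F.HomS P, ∀ x : P, (x : S) ∉ T → ∀ z : T, f x = z → ∑ i, (θ i z : ℂ) = 0) ∧
      ∀ t, (∀ i, θ i t = 1) → t = 1 := by
  let norms : Set (Subgroup T) :=
    .range fun α : F.aut T => (cyclicNorm T.index (α : MulAut T)).range
  have hdiv : ∀ D ∈ norms, ∀ n ≠ 0, ∀ d ∈ D, ∃ c ∈ D, c ^ n = d := by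
    rintro _ ⟨α, rfl⟩ n hn _ ⟨t, rfl⟩
    obtain ⟨s, rfl⟩ := hT.exists_pow_eq_of_ne_zero hn t
    exact ⟨_, ⟨s, rfl⟩, (map_pow _ s n).symm⟩
  have hindex := T.index_ne_zero_of_finite
  obtain ⟨I, hI, hI', θ, hinv, hvan, hone⟩ := hT.exists_vanishing_characters (F.aut T)
    (Set.finite_range _ : norms.Finite) hdiv (mul_ne_zero hindex hindex)
  refine ⟨I, hI, hI', θ, hinv, fun P f hf x hx z hz => ?_, hone⟩
  obtain ⟨w, hw, α, hα, hwz, hwzn⟩ := hF.exists_notMem_range_cyclicNorm hS hT hf hx hz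
  rw [← hinv w hw, hvan _ ⟨⟨α, hα⟩, rfl⟩ _ hwz hwzn]

end FusionSystem

section InducedRepresentation

variable {S : Type*} [Group S] {T : Subgroup S}

/-- The cocycle `S × S/T → T` describing the left action of `S` on itself in terms of the
representatives `Quotient.out` of the cosets of `T`. -/
noncomputable def cosetCocycle (T : Subgroup S) (s : S) (x : S ⧸ T) : T :=
  ⟨x.out⁻¹ * (s * (s⁻¹ • x).out), by
    rw [← QuotientGroup.eq, QuotientGroup.out_eq', ← smul_eq_mul, ← MulAction.Quotient.smul_mk,
      QuotientGroup.out_eq', smul_inv_smul]⟩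

theorem cosetCocycle_mul (s t : S) (x : S ⧸ T) :
    cosetCocycle T (s * t) x = cosetCocycle T s x * cosetCocycle T t (s⁻¹ • x) := by
  apply Subtype.ext
  simp only [cosetCocycle, Subgroup.coe_mul, mul_inv_rev, mul_smul]
  group

theorem cosetCocycle_one (x : S ⧸ T) : cosetCocycle T 1 x = 1 :=
  Subtype.ext (by simp [cosetCocycle])

theorem inv_smul_quotient_eq_self_iff [T.Normal] {s : S} {x : S ⧸ T} : s⁻¹ • x = x ↔ s ∈ T := by
  obtain ⟨g, rfl⟩ := QuotientGroup.mk_surjective x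
  rw [MulAction.Quotient.smul_mk, QuotientGroup.eq, smul_eq_mul, mul_inv_rev, inv_inv,
    Subgroup.Normal.mem_comm_iff ‹_›, mul_inv_cancel_left]

theorem cosetCocycle_coe [T.Normal] (t : T) (x : S ⧸ T) :
    cosetCocycle T t x = MulAut.conjNormal x.out⁻¹ t := by
  apply Subtype.ext
  simp only [cosetCocycle, inv_smul_quotient_eq_self_iff.mpr t.2, MulAut.conjNormal_apply, inv_inv,
    mul_assoc]

variable {I : Type*} (θ : I → T →* Circle)

/-- The representation of `S` induced by the direct sum of the characters `θ i` of `T`. -/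
noncomputable def inducedRep : Representation ℂ S (EuclideanSpace ℂ ((S ⧸ T) × I)) where
  toFun s :=
    { toFun := fun v => WithLp.toLp 2 fun k =>
        (θ k.2 (cosetCocycle T s k.1) : ℂ) * v (s⁻¹ • k.1, k.2)
      map_add' := fun v w => by ext k; simp [mul_add]
      map_smul' := fun c v => by ext k; simp [mul_left_comm] }
  map_one' := by ext v k; simp [cosetCocycle_one]
  map_mul' s t := by ext v k; simp [cosetCocycle_mul, mul_smul, mul_assoc]

theorem inducedRep_apply (s : S) (v : EuclideanSpace ℂ ((S ⧸ T) × I)) (x : S ⧸ T) (i : I) :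
    inducedRep θ s v (x, i) = (θ i (cosetCocycle T s x) : ℂ) * v (s⁻¹ • x, i) := rfl

theorem inducedRep_single [DecidableEq ((S ⧸ T) × I)] [T.Normal] (s : S) (x : S ⧸ T) (i : I)
    [Decidable (s ∈ T)] :
    inducedRep θ s (EuclideanSpace.single (x, i) 1) (x, i) =
      if s ∈ T then (θ i (cosetCocycle T s x) : ℂ) else 0 := by
  have hiff : (s⁻¹ • x, i) = (x, i) ↔ s ∈ T := by simp [inv_smul_quotient_eq_self_iff]
  rw [inducedRep_apply, PiLp.single_apply, mul_ite, mul_one, mul_zero]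
  simp only [hiff]

theorem inducedRep_injective [T.Normal] [Nonempty I] (hθ : ∀ t, (∀ i, θ i t = 1) → t = 1) :
    Function.Injective (inducedRep θ) := by
  classical
  refine (injective_iff_map_eq_one _).mpr fun s hs => ?_
  have hone : ∀ i, (if s ∈ T then (θ i (cosetCocycle T s (1 : S)) : ℂ) else 0) = 1 := fun i => by
    rw [← inducedRep_single, hs]
    simp
  have hsT : s ∈ T := by
    by_contra h
    exact one_ne_zero ((hone (Classical.arbitrary I)).symm.trans (if_neg h))
  have hconj := hθ _ fun i => Circle.coe_eq_one.mp ((if_pos hsT).symm.trans (hone i))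
  rw [cosetCocycle_coe ⟨s, hsT⟩, map_eq_one_iff _ (MulEquiv.injective _)] at hconj
  exact congrArg Subtype.val hconj

theorem inner_inducedRep [Fintype (S ⧸ T)] [Fintype I] (s : S)
    (v w : EuclideanSpace ℂ ((S ⧸ T) × I)) :
    inner ℂ (inducedRep θ s v) (inducedRep θ s w) = inner ℂ v w := by
  rw [PiLp.inner_apply, PiLp.inner_apply]
  refine Fintype.sum_equiv ((MulAction.toPerm s⁻¹).prodCongr (Equiv.refl I)) _ _ fun ⟨x, i⟩ => ?_
  rw [inducedRep_apply, inducedRep_apply, ← smul_eq_mul, ← smul_eq_mul, inner_smul_left,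
    inner_smul_right, ← mul_assoc, ← Circle.coe_inv_eq_conj, ← Circle.coe_mul, inv_mul_cancel,
    Circle.coe_one, one_mul]
  rfl

theorem character_inducedRep [Fintype (S ⧸ T)] [Fintype I] [T.Normal] (s : S)
    [Decidable (s ∈ T)] :
    (inducedRep θ).character s =
      ∑ k : (S ⧸ T) × I, if s ∈ T then (θ k.2 (cosetCocycle T s k.1) : ℂ) else 0 := by
  classical
  rw [Representation.character, LinearMap.trace_eq_sum_inner _ (EuclideanSpace.basisFun _ ℂ)]
  refine Finset.sum_congr rfl fun k _ => ?_
  rw [EuclideanSpace.basisFun_apply, EuclideanSpace.inner_single_left, map_one, one_mul,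
    inducedRep_single]

theorem character_inducedRep_of_notMem [Finite (S ⧸ T)] [Finite I] [T.Normal] {s : S}
    (hs : s ∉ T) : (inducedRep θ).character s = 0 := by
  classical
  cases nonempty_fintype (S ⧸ T)
  cases nonempty_fintype I
  simp [character_inducedRep, hs]

theorem character_inducedRep_coe [Finite (S ⧸ T)] [Fintype I] [T.Normal]
    (hθ : ∀ (s : S) (t : T), ∑ i, (θ i (MulAut.conjNormal s t) : ℂ) = ∑ i, (θ i t : ℂ)) (t : T) :
    (inducedRep θ).character t = T.index * ∑ i, (θ i t : ℂ) := by
  classical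
  cases nonempty_fintype (S ⧸ T)
  simp only [character_inducedRep, SetLike.coe_mem, if_true, cosetCocycle_coe]
  rw [Fintype.sum_prod_type]
  simp only [hθ, Finset.sum_const, Finset.card_univ, nsmul_eq_mul, Subgroup.index_eq_card,
    Nat.card_eq_fintype_card]

end InducedRepresentation

theorem exists_unitary_fin_of_unitary {G V : Type*} [Group G] [NormedAddCommGroup V]
    [InnerProductSpace ℂ V] [FiniteDimensional ℂ V] {ρ : Representation ℂ G V}
    (hinner : ∀ g v w, inner ℂ (ρ g v) (ρ g w) = inner ℂ v w) (hinj : Function.Injective ρ) :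
    ∃ (n : ℕ) (σ : Representation ℂ G (EuclideanSpace ℂ (Fin n))),
      (∀ g v w, inner ℂ (σ g v) (σ g w) = inner ℂ v w) ∧ Function.Injective σ ∧
        σ.character = ρ.character := by
  let e := (stdOrthonormalBasis ℂ V).repr
  refine ⟨Module.finrank ℂ V,
    (e.toLinearEquiv.conjRingEquiv : _ →* Module.End ℂ (EuclideanSpace ℂ _)).comp ρ,
    fun g v w => ?_, e.toLinearEquiv.conjRingEquiv.injective.comp hinj, funext fun g => ?_⟩
  · change inner ℂ (e (ρ g (e.symm v))) (e (ρ g (e.symm w))) = inner ℂ v w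
    rw [e.inner_map_map, hinner, e.symm.inner_map_map]
  · exact LinearMap.trace_conj' (ρ g) e.toLinearEquiv

theorem finite_of_fg_of_isMulCommutative_of_finiteIndex {S : Type*} [Group S] {T : Subgroup S}
    [IsMulCommutative T] [T.FiniteIndex] (hS : IsMulTorsion S) {H : Subgroup S}
    (hH : H.FG) : Finite H := by
  have := (Group.fg_iff_subgroup_fg H).mpr hH
  have : Finite (T.subgroupOf H) := CommGroup.finite_of_fg_isMulTorsion _
    ((hS.subgroup H).subgroup _)
  exact Finite.of_subgroup_quotient (T.subgroupOf H)

namespace FusionSystem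

variable {S : Type*} [Group S] {F : FusionSystem S}

theorem isInvariant_of_character_eq {V : Type*} [AddCommGroup V] [Module ℂ V]
    [FiniteDimensional ℂ V] {ρ : Representation ℂ S V} (hS : ∀ H : Subgroup S, H.FG → Finite H)
    (h : ∀ P, ∀ f ∈ F.HomS P, ∀ x : P, ρ.character x = ρ.character (f x)) :
    F.IsInvariant ρ := fun P f hf =>
  nonempty_equiv_of_character_eq_of_locallyFinite
    (fun s => by
      have := hS ((Subgroup.closure (s : Set P)).map P.subtype) ((Subgroup.fg_iff _).mpr
        ⟨P.subtype '' s, (P.subtype.map_closure _).symm, s.finite_toSet.image _⟩)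
      exact .of_equiv _ ((Subgroup.closure (s : Set P)).equivMapOfInjective _
        P.subtype_injective).symm.toEquiv)
    (funext fun x => h P f hf x)

variable {p : ℕ} [Fact p.Prime] {T : Subgroup S} [T.Normal] [IsMulCommutative T] [T.FiniteIndex]

theorem HasExtensions.apply_eq_apply (hF : F.HasExtensions p) (hS : IsPGroup p S)
    (hT : IsPTorus p T) {χ : S → ℂ} (hoff : ∀ s ∉ T, χ s = 0)
    (hinv : ∀ w ∈ F.aut T, ∀ t : T, χ (w t) = χ t)
    (hvan : ∀ P, ∀ f ∈ F.HomS P, ∀ x : P, (x : S) ∉ T → ∀ z : T, f x = z → χ z = 0)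
    {P : Subgroup S} {f : P →* S} (hf : f ∈ F.HomS P) (x : P) : χ x = χ (f x) := by
  by_cases hx : (x : S) ∈ T <;> by_cases hfx : f x ∈ T
  · have hle : Subgroup.zpowers (x : S) ≤ P := Subgroup.zpowers_le.mpr x.2
    obtain ⟨w, hw, hwf⟩ := hF.exists_aut_eq hS hT (Subgroup.zpowers_le.mpr hx)
      (F.restrict_mem_homS hf hle) (by
        rintro ⟨_, n, rfl⟩
        exact (map_zpow f x n).symm ▸ T.zpow_mem hfx n)
    rw [← hinv w hw ⟨x, hx⟩, hwf ⟨x, Subgroup.mem_zpowers _⟩]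
    rfl
  · obtain ⟨g, hg, hgf⟩ := F.exists_inverse_mem_homS hf
    rw [hoff _ hfx, hvan _ g hg (f.rangeRestrict x) hfx ⟨x, hx⟩ (hgf x)]
  · rw [hoff _ hx, hvan P f hf x hx ⟨f x, hfx⟩ rfl]
  · rw [hoff _ hx, hoff _ hfx]

end FusionSystem

theorem theorem3p7_general {p : ℕ} [Fact p.Prime] {S : Type*} [Group S] {T : Subgroup S}
    [T.Normal] [IsMulCommutative T] [T.FiniteIndex] (hS : IsPGroup p S) (hT : IsPTorus p T)
    (F : FusionSystem S) [Finite (F.aut T)] (hF : F.HasExtensions p) :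
    ∃ (n : ℕ) (ρ : Representation ℂ S (EuclideanSpace ℂ (Fin n))),
      (∀ (s : S) (v w : EuclideanSpace ℂ (Fin n)), inner ℂ (ρ s v) (ρ s w) = inner ℂ v w) ∧
        Function.Injective ρ ∧ F.IsInvariant ρ := by
  cases nonempty_fintype (S ⧸ T)
  obtain ⟨I, _, _, θ, hinv, hvan, hone⟩ := hF.exists_vanishing_characters hS hT
  obtain ⟨n, ρ, hinner, hinj, hρ⟩ :=
    exists_unitary_fin_of_unitary (inner_inducedRep θ) (inducedRep_injective θ hone)
  have hoff : ∀ s ∉ T, ρ.character s = 0 := fun s hs => by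
    rw [hρ, character_inducedRep_of_notMem θ hs]
  have hon : ∀ t : T, ρ.character t = T.index * ∑ i, (θ i t : ℂ) := fun t => by
    rw [hρ, character_inducedRep_coe θ fun s => hinv _ (FusionSystem.conjNormal_mem_aut s)]
  have hfinite : ∀ H : Subgroup S, H.FG → Finite H := fun H =>
    finite_of_fg_of_isMulCommutative_of_finiteIndex (T := T)
      (hS.isOfFinOrder (Fact.out : p.Prime).ne_zero)
  refine ⟨n, ρ, hinner, hinj, FusionSystem.isInvariant_of_character_eq hfinite fun P f hf =>
    hF.apply_eq_apply hS hT hoff (fun w hw t => ?_) (fun P f hf x hx z hz => ?_) hf⟩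
  · rw [hon, hon, hinv w hw]
  · rw [hon, hvan P f hf x hx z hz, mul_zero]

/-- A saturated fusion system over a discrete `p`-toral group `S` has a faithful invariant unitary
representation of `S` on some `ℂⁿ`. -/
theorem theorem3p7 {p : ℕ} (hp : p.Prime) {S : Type*} [Group S] (hS : IsDiscretePToral p S)
    (F : FusionSystem S) (hF : F.IsSaturated p) :
    ∃ (n : ℕ) (ρ : Representation ℂ S (EuclideanSpace ℂ (Fin n))),
      (∀ (s : S) (v w : EuclideanSpace ℂ (Fin n)), inner ℂ (ρ s v) (ρ s w) = inner ℂ v w) ∧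
        Function.Injective ρ ∧ F.IsInvariant ρ := by
  have := Fact.mk hp
  obtain ⟨T, _, _, _, hpS, hT⟩ := hS.exists_isPTorus
  have := hF.finite_aut hpS hT
  exact theorem3p7_general hpS hT F hF.extension
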